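/- Let $d\ge 1$, $n\ge 0$, $\lambda=(\lambda_1,\dots,\lambda_n)\in[0,1]^n$. For a probability distribution $P$ on $\mathbb R^d$ with mean $\mu_P$, a random dataset $Z=(Z_1,\dots,Z_n)$ is $\lambda$-contaminated from $P$, written $Z\sim_\lambda P$, if $Z_i=(1-B_i)X_i+B_i\tilde X_i$, where $X_1,\dots,X_n$ are i.i.d. from $P$, $B_i\sim\mathrm{Bern}(\lambda_i)$ are independent of each other and of the $X_i$, and the outliers $(\tilde X_1,\dots,\tilde X_n)$ are drawn from an arbitrary joint distribution conditional on $(X_1,\dots,X_n,B_1,\dots,B_n)$ (the adversary). For a class $\mathcal D$ of distributions on $\mathbb R^d$ let $$L_{\mathsf{PAC}}(\lambda,\mathcal D)=\inf\Big\{t:\ \inf_M\ \sup_{P\in\mathcal D}\ \Pr_{Z\sim_\lambda P}\big[\|M(Z)-\mu_P\|_2^2\ge t\big]\le \tfrac15\Big\},$$ where $M$ ranges over all estimators and the supremum is over both $P\in\mathcal D$ and the adversary. Let $\mathcal D_d^{\mathcal N}=\{\mathcal N(\mu,I_d):\mu\in\mathbb R^d\}$, $N(t)=|\{i:\lambda_i\le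 t\}|$, and $$f(\lambda,d)=\min_{t\in[0,1]}\Big(t^2+\frac{d}{N(t)}\Big),$$ with $d/0=+\infty$. For weights $w\in\mathbb R_{\ge 0}^n$, the weighted Tukey depth of $\eta\in\mathbb R^d$ in $Z$ is $D_w(\eta,Z)=\min_{\|v\|_2=1}\sum_{i=1}^n w_i\,\mathbb 1\{v^{T}(Z_i-\eta)\ge 0\}$, and a weighted Tukey median is a maximizer of $\eta\mapsto D_w(\eta,Z)$. Let $w(t)_i=\mathbb 1\{\lambda_i\le t\}/N(t)$ (and $w(t)=0$ if $N(t)=0$). **Theorem.** There are universal constants $c,c_1,C>0$ such that for all $d\ge1$, $n$ and $\lambda\in[0,1]^n$ with $f(\lambda,d)\le c$, $$\frac{c_1}{\sqrt d}\, f(\lambda,d)\ \le\ L_{\mathsf{PAC}}(\lambda,\mathcal D_d^{\mathcal N})\ \le\ C\, f(\lambda,d).$$ Moreover, the minimum defining $f(\lambda,d)$ is attained, weighted Tukey medians with weights $w(t)$ exist for every $t\in[0,1]$ and every dataset, and for every minimizer $t^*\in\arg\min_{t\in[0,1]}(t^2+d/N(t))$ every weighted Tukey median $\hat\mu(Z)$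 with weights $w(t^*)$ attains the upper bound: $$\sup_{P\in\mathcal D_d^{\mathcal N}}\Pr_{Z\sim_\lambda P}\big[\|\hat\mu(Z)-\mu_P\|_2^2\ge C\, f(\lambda,d)\big]\le\tfrac15,$$ the supremum again being over both $P$ and the adversary. -/

import Mathlib

open MeasureTheory ProbabilityTheory
open scoped ENNReal NNReal unitInterval

noncomputable section

/-- The possible laws of a `lam`-contaminated dataset `Z = (Z₁, …, Zₙ)` with clean distribution `P`.
The clean samples `X` are i.i.d. from `P`, the flags `B i ~ Bern (lam i)` are independent of each
other and of `X`, and the adversary is an arbitrary Markov kernel `κ` drawing the outliers `X'`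
jointly, conditionally on `(X, B)`. The observed sample is `Z i = (1 - B i) X i + B i X' i`. -/
def contaminatedLaws {n : ℕ} {E : Type*} [MeasurableSpace E] (lam : Fin n → I) (P : Measure E) :
    Set (Measure (Fin n → E)) :=
  {ν | ∃ κ : Kernel ((Fin n → E) × (Fin n → Bool)) (Fin n → E), IsMarkovKernel κ ∧
    ν = (((Measure.pi fun _ ↦ P).prod
        (Measure.pi fun i ↦ bernoulliMeasure true false (lam i))) ⊗ₘ κ).map
      (fun q i ↦ if q.1.2 i = true then q.2 i else q.1.1 i)}

/-- The minimax PAC rate, with failure probability `δ`, for squared `ℓ²` error of mean estimation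
over the class `𝒟` under `lam`-contamination. Estimators are the measurable maps, and the supremum
is over the clean distribution and over the adversary. -/
def minimaxPAC {n d : ℕ} (lam : Fin n → I) (𝒟 : Set (Measure (EuclideanSpace ℝ (Fin d))))
    (δ : ℝ≥0∞) : ℝ≥0∞ :=
  sInf {t : ℝ≥0∞ |
    (⨅ (M : (Fin n → EuclideanSpace ℝ (Fin d)) → EuclideanSpace ℝ (Fin d)) (_ : Measurable M),
      ⨆ P ∈ 𝒟, ⨆ ν ∈ contaminatedLaws lam P, ν {z | t ≤ ‖M z - ∫ x, x ∂P‖ₑ ^ 2}) ≤ δ}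

/-- The Gaussian distributions on `ℝ^d` with identity covariance. -/
def idGaussians (d : ℕ) : Set (Measure (EuclideanSpace ℝ (Fin d))) :=
  {P | ∃ μ : EuclideanSpace ℝ (Fin d), P = multivariateGaussian μ 1}

/-- `N(t) = |{i : lam i ≤ t}|`. -/
def numBelow {n : ℕ} (lam : Fin n → I) (t : I) : ℕ :=
  (Finset.univ.filter fun i ↦ lam i ≤ t).card

/-- `t² + d / N(t)`, equal to `∞` when `N(t) = 0 < d`. -/
def thresholdObjective {n : ℕ} (d : ℕ) (lam : Fin n → I) (t : I) : ℝ≥0∞ :=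
  ENNReal.ofReal ((t : ℝ) ^ 2) + (d : ℝ≥0∞) / (numBelow lam t : ℝ≥0∞)

/-- `f(lam, d) = min_{t ∈ [0,1]} (t² + d / N(t))`. -/
def effectiveRate {n : ℕ} (d : ℕ) (lam : Fin n → I) : ℝ≥0∞ :=
  ⨅ t : I, thresholdObjective d lam t

open Classical in
/-- The weighted Tukey depth of `η` in the dataset `z`: the minimum over unit vectors `v` of the
weight of the samples in the closed half-space `⟪v, x - η⟫ ≥ 0`. -/
def tukeyDepth {n d : ℕ} (w : Fin n → ℝ) (z : Fin n → EuclideanSpace ℝ (Fin d))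
    (η : EuclideanSpace ℝ (Fin d)) : ℝ :=
  ⨅ v : Metric.sphere (0 : EuclideanSpace ℝ (Fin d)) 1,
    ∑ i, w i * (if 0 ≤ inner ℝ (v : EuclideanSpace ℝ (Fin d)) (z i - η) then 1 else 0)

/-- `η` is a weighted Tukey median of `z`: a maximizer of the weighted Tukey depth. -/
def IsTukeyMedian {n d : ℕ} (w : Fin n → ℝ) (z : Fin n → EuclideanSpace ℝ (Fin d))
    (η : EuclideanSpace ℝ (Fin d)) : Prop :=
  ∀ η', tukeyDepth w z η' ≤ tukeyDepth w z η

/-- The weights `w(t)`, uniform on the samples with `lam i ≤ t` and zero on the others. -/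
def thresholdWeights {n : ℕ} (lam : Fin n → I) (t : I) (i : Fin n) : ℝ :=
  if lam i ≤ t then 1 / (numBelow lam t : ℝ) else 0

end

/-! Upper bound. Keep the `N = N(t)` samples with `lam i ≤ t`. The half-spaces at a fixed signed
distance from `μ` have VC dimension at most `d + 1`, so outside a small event all their clean counts
are at least `N p - e`, where `p` is the Gaussian mass and `e` is of order `√(dN) + tN`. Markov's
inequality bounds the number of corrupted samples by `e` too, whatever the adversary does. Hence
every half-space through `μ` holds at least `a ≈ N/2 - 2e` points, and every half-space reaching a
distance `s` beyond `μ` holds at least `b ≈ N(1/2 + s/6) - 2e`. Once `s` is a large multiple of `t +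
√(d/N)`, `a + b > N`. If a point `η` of depth at least `a` were farther than `s` from `μ`, two
opposite half-spaces of these kinds, along `η - μ`, would be disjoint and hold more than `N` points.
A Tukey median is at least as deep as `μ`, hence is such a point. The key steps are
`rademacherSup_le_of_vcDim_le` (chaining), `integral_sup_deviation_le` (symmetrization) and
`norm_sub_le_of_uniformlyDeep`. Since an arbitrary choice of medians need not be measurable, the
minimax bound uses a measurable relative, from `exists_measurable_estimator`.

Lower bound. Place the mean at a vertex of a cube `{±a}^k` on `k` coordinates. The pointwise maximum
of the `2^k` densities has mass at most `exp (3ak)`, so its normalization dominates `(1 - p)` times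
every vertex law as soon as `p ≥ 3ak`. With threshold `t = 3ak` the adversary therefore makes all
samples with `lam i > t` uninformative (`exists_common_law`) and leaves the others clean. If `N(t)
a²` is small, adjacent vertices cannot be told apart, and Assouad's argument (`exists_card_ne_ge`)
forces an error of order `k a²`. The definition of `f` gives `N(t) ≤ 2d/f` once `t² ≤ f/2`, which
allows `a² ≈ f/d`; then `t² ≤ f/2` limits `k` to order `√d`. The error is `k a² ≈ f/√d`, which is
where the factor `√d` is lost. -/

/-! ### Rademacher averages of finite classes. -/

section Rademacher

variable {ι τ : Type*} [Fintype ι]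

/-- The Rademacher sum `∑ ± aᵢ` with signs given by `ε`. -/
noncomputable def signedSum (ε : ι → Bool) (a : ι → ℝ) : ℝ :=
  ∑ i, (if ε i then 1 else -1) * a i

lemma signedSum_sub (ε : ι → Bool) (a b : ι → ℝ) :
    signedSum ε (fun i ↦ a i - b i) = signedSum ε a - signedSum ε b := by
  simp [signedSum, mul_sub, Finset.sum_sub_distrib]

variable [DecidableEq ι]

/-- The average over all signs. -/
noncomputable def signAverage (F : (ι → Bool) → ℝ) : ℝ :=
  (∑ ε, F ε) / 2 ^ Fintype.card ι

lemma signAverage_mono {F G : (ι → Bool) → ℝ} (h : ∀ ε, F ε ≤ G ε) :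
    signAverage F ≤ signAverage G := by
  unfold signAverage
  gcongr with ε
  exact h ε

lemma signAverage_add (F G : (ι → Bool) → ℝ) :
    signAverage (fun ε ↦ F ε + G ε) = signAverage F + signAverage G := by
  simp [signAverage, Finset.sum_add_distrib, add_div]

lemma signAverage_const (c : ℝ) : signAverage (fun _ : ι → Bool ↦ c) = c := by
  simp [signAverage]

lemma signAverage_const_mul (c : ℝ) (F : (ι → Bool) → ℝ) :
    signAverage (fun ε ↦ c * F ε) = c * signAverage F := by
  simp [signAverage, ← Finset.mul_sum, mul_div_assoc]

lemma signAverage_sum (T : Finset τ) (F : τ → (ι → Bool) → ℝ) :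
    signAverage (fun ε ↦ ∑ t ∈ T, F t ε) = ∑ t ∈ T, signAverage (F t) := by
  simp only [signAverage]
  rw [Finset.sum_comm, Finset.sum_div]

/-- Independence of the signs factors the average into `∏ cosh (l * a i)`, and `cosh x ≤ exp (x² /
2)`: Rademacher sums are sub-Gaussian. -/
lemma signAverage_exp_le (l : ℝ) (a : ι → ℝ) :
    signAverage (fun ε ↦ Real.exp (l * signedSum ε a)) ≤ Real.exp (l ^ 2 * (∑ i, a i ^ 2) / 2) := by
  have h1 : ∑ ε : ι → Bool, Real.exp (l * signedSum ε a)
      = ∏ i, (Real.exp (l * a i) + Real.exp (-(l * a i))) := by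
    have := Finset.prod_univ_sum (fun _ : ι ↦ (Finset.univ : Finset Bool))
      (fun i b ↦ Real.exp (l * ((if b then 1 else -1) * a i)))
    rw [Fintype.piFinset_univ] at this
    simp only [signedSum, Finset.mul_sum, Real.exp_sum]
    rw [← this]
    refine Finset.prod_congr rfl fun i _ ↦ ?_
    simp
  have h2 : ∀ i, Real.exp (l * a i) + Real.exp (-(l * a i)) = 2 * Real.cosh (l * a i) := by
    intro i; rw [Real.cosh_eq]; ring
  have h3 : Real.exp (l ^ 2 * (∑ i, a i ^ 2) / 2) = ∏ i, Real.exp ((l * a i) ^ 2 / 2) := by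
    rw [← Real.exp_sum, Finset.mul_sum, Finset.sum_div]
    simp [mul_pow]
  rw [signAverage, h1, Finset.prod_congr rfl (fun i _ ↦ h2 i), Finset.prod_mul_distrib, h3]
  simp only [Finset.prod_const, Finset.card_univ]
  rw [mul_div_cancel_left₀ _ (by positivity)]
  exact Finset.prod_le_prod (fun i _ ↦ (Real.cosh_pos _).le)
    fun i _ ↦ Real.cosh_le_exp_half_sq _

/-- The Rademacher average of the supremum of a finite family of linear functionals. -/
noncomputable def rademacherSup (T : Finset τ) (hT : T.Nonempty) (a : τ → ι → ℝ) : ℝ :=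
  signAverage fun ε ↦ T.sup' hT fun t ↦ |signedSum ε (a t)|

/-- Massart's finite class lemma. -/
lemma rademacherSup_le (T : Finset τ) (hT : T.Nonempty) (a : τ → ι → ℝ) {S L : ℝ}
    (hS : 0 < S) (ha : ∀ t ∈ T, ∑ i, a t i ^ 2 ≤ S) (hL : 0 < L)
    (hcard : Real.log (2 * T.card) ≤ L) : rademacherSup T hT a ≤ Real.sqrt (2 * S * L) := by
  -- This `l` minimizes `(L + l² S / 2) / l`; the two terms of `b` become equal, so `b = 2L`.
  set l : ℝ := Real.sqrt (2 * L / S) with hl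
  have hl0 : 0 < l := Real.sqrt_pos.2 (by positivity)
  have hl2 : l ^ 2 = 2 * L / S := Real.sq_sqrt (by positivity)
  set b : ℝ := L + l ^ 2 * S / 2 with hb
  have hb2 : b = 2 * L := by rw [hb, hl2]; field_simp; ring
  have hcard' : (2 * T.card : ℝ) ≤ Real.exp L := by
    have : (0 : ℝ) < 2 * T.card := by have := hT.card_pos; positivity
    rwa [← Real.log_le_iff_le_exp this]
  have key : l * rademacherSup T hT a ≤ b := by
    rw [rademacherSup, ← signAverage_const_mul]
    calc signAverage (fun ε : ι → Bool ↦ l * T.sup' hT fun t ↦ |signedSum ε (a t)|)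
        ≤ signAverage (fun ε ↦ (b - 1) + Real.exp (-b) * ∑ t ∈ T,
            (Real.exp (l * signedSum ε (a t)) + Real.exp ((-l) * signedSum ε (a t)))) := by
          refine signAverage_mono fun ε ↦ ?_
          obtain ⟨t, ht, hte⟩ := Finset.exists_mem_eq_sup' hT fun t ↦ |signedSum ε (a t)|
          rw [hte]
          -- The tangent inequality `y ≤ (b - 1) + exp (y - b)` takes the place of Jensen's
          -- inequality for the logarithm.
          have h1 := Real.add_one_le_exp (l * |signedSum ε (a t)| - b)
          have h2 : Real.exp (l * |signedSum ε (a t)| - b)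
              = Real.exp (-b) * Real.exp (l * |signedSum ε (a t)|) := by
            rw [← Real.exp_add]; ring_nf
          have h3 : Real.exp (l * |signedSum ε (a t)|)
              ≤ Real.exp (l * signedSum ε (a t)) + Real.exp ((-l) * signedSum ε (a t)) := by
            rcases abs_cases (signedSum ε (a t)) with h | h
            · rw [h.1]; linarith [Real.exp_pos ((-l) * signedSum ε (a t))]
            · rw [h.1, mul_neg, ← neg_mul]; linarith [Real.exp_pos (l * signedSum ε (a t))]
          have h4 : Real.exp (l * signedSum ε (a t)) + Real.exp ((-l) * signedSum ε (a t))
              ≤ ∑ t ∈ T, (Real.exp (l * signedSum ε (a t)) +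
                Real.exp ((-l) * signedSum ε (a t))) :=
            Finset.single_le_sum (f := fun t ↦ Real.exp (l * signedSum ε (a t)) +
                Real.exp ((-l) * signedSum ε (a t))) (fun t _ ↦ by positivity) ht
          have h5 := mul_le_mul_of_nonneg_left (h3.trans h4) (Real.exp_pos (-b)).le
          linarith
      _ ≤ (b - 1) + Real.exp (-b) * ∑ t ∈ T, (2 * Real.exp (l ^ 2 * S / 2)) := by
          rw [signAverage_add, signAverage_const, signAverage_const_mul, signAverage_sum]
          gcongr with t ht
          rw [signAverage_add]
          have h1 := signAverage_exp_le l (a t)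
          have h2 := signAverage_exp_le (-l) (a t)
          have h3 : Real.exp (l ^ 2 * (∑ i, a t i ^ 2) / 2) ≤ Real.exp (l ^ 2 * S / 2) := by
            gcongr; exact ha t ht
          rw [neg_sq] at h2
          linarith
      _ ≤ b := by
          rw [Finset.sum_const, nsmul_eq_mul]
          have : Real.exp (-b) * (T.card * (2 * Real.exp (l ^ 2 * S / 2)))
              ≤ Real.exp (-b) * (Real.exp L * Real.exp (l ^ 2 * S / 2)) := by
            gcongr _ * ?_
            nlinarith [Real.exp_pos (l ^ 2 * S / 2)]
          rw [← Real.exp_add, ← Real.exp_add, show -b + (L + l ^ 2 * S / 2) = 0 by rw [hb]; ring,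
            Real.exp_zero] at this
          linarith
  rw [hb2] at key
  refine Real.le_sqrt_of_sq_le ?_
  have hR : 0 ≤ rademacherSup T hT a := by
    rw [rademacherSup, ← signAverage_const (ι := ι) 0]
    refine signAverage_mono fun ε ↦ ?_
    obtain ⟨t, ht⟩ := hT
    exact (abs_nonneg _).trans (Finset.le_sup' (fun t ↦ |signedSum ε (a t)|) ht)
  have h1 : (l * rademacherSup T hT a) ^ 2 ≤ (2 * L) ^ 2 :=
    pow_le_pow_left₀ (by positivity) key 2
  rw [mul_pow, hl2, div_mul_eq_mul_div, div_le_iff₀ hS] at h1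
  nlinarith

/-- The indicator vector of a finite set. -/
def indicatorVec (f : Finset ι) (i : ι) : ℝ := if i ∈ f then 1 else 0

lemma sum_sq_indicatorVec_sub (f g : Finset ι) :
    ∑ i, (indicatorVec f i - indicatorVec g i) ^ 2 = (symmDiff f g).card := by
  rw [Finset.card_eq_sum_ones, Nat.cast_sum, ← Finset.sum_filter_add_sum_filter_not Finset.univ
    (fun i ↦ i ∈ symmDiff f g)]
  have h : Finset.univ.filter (fun i ↦ i ∈ symmDiff f g) = symmDiff f g := by ext; simp
  rw [h, Finset.sum_eq_zero (s := Finset.univ.filter (fun i ↦ i ∉ symmDiff f g)), add_zero]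
  · refine Finset.sum_congr rfl fun i hi ↦ ?_
    rw [Finset.mem_symmDiff] at hi
    rcases hi with hi | hi <;> simp [indicatorVec, hi]
  · intro i hi
    simp only [Finset.mem_filter, Finset.mem_univ, true_and, Finset.mem_symmDiff] at hi
    by_cases h1 : i ∈ f <;> by_cases h2 : i ∈ g <;> simp_all [indicatorVec]

lemma sum_sq_indicatorVec_le (f : Finset ι) :
    ∑ i, indicatorVec f i ^ 2 ≤ Fintype.card ι := by
  calc ∑ i, indicatorVec f i ^ 2 ≤ ∑ _i : ι, (1 : ℝ) := by
        refine Finset.sum_le_sum fun i _ ↦ ?_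
        unfold indicatorVec; split_ifs <;> norm_num
    _ = Fintype.card ι := by simp

/-- One step of chaining: passing from a net to a finer family. -/
lemma rademacherSup_le_add (A B : Finset (Finset ι)) (hA : A.Nonempty) (hB : B.Nonempty)
    {r L : ℝ} (hr : 0 < r) (hL : 0 < L) (hcard : Real.log (2 * B.card) ≤ L)
    (hnet : ∀ f ∈ B, ∃ g ∈ A, ((symmDiff f g).card : ℝ) ≤ r) :
    rademacherSup B hB indicatorVec ≤ rademacherSup A hA indicatorVec + Real.sqrt (2 * r * L) := by
  choose! p hpA hp using hnet
  have h := rademacherSup_le B hB (fun f i ↦ indicatorVec f i - indicatorVec (p f) i) hr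
    (fun f hf ↦ by rw [sum_sq_indicatorVec_sub]; exact hp f hf) hL hcard
  refine le_trans ?_ (add_le_add_right h _)
  rw [rademacherSup, rademacherSup, rademacherSup, ← signAverage_add]
  refine signAverage_mono fun ε ↦ Finset.sup'_le _ _ fun f hf ↦ ?_
  have h1 := Finset.le_sup' (fun t ↦ |signedSum ε (indicatorVec t)|) (hpA f hf)
  have h2 := Finset.le_sup'
    (fun f ↦ |signedSum ε (fun i ↦ indicatorVec f i - indicatorVec (p f) i)|) hf
  simp only [signedSum_sub] at h2 ⊢
  have h3 := abs_add_le (signedSum ε (indicatorVec (p f)))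
    (signedSum ε (indicatorVec f) - signedSum ε (indicatorVec (p f)))
  rw [add_sub_cancel] at h3
  linarith

end Rademacher

/-! ### Packing numbers and chaining for classes of bounded VC dimension. -/

section VC

variable {ι κ : Type*} [DecidableEq ι] [Fintype κ] [DecidableEq κ]

/-- Weighting each term by `(V / k) ^ V ≤ (V / k) ^ j` turns the sum into part of the binomial
expansion of `(1 + V / k) ^ k ≤ exp V`. -/
lemma sum_choose_le_pow {k V : ℕ} (hV : 0 < V) (hk : V ≤ k) :
    (∑ j ∈ Finset.Iic V, (k.choose j : ℝ)) ≤ (Real.exp 1 * k / V) ^ V := by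
  have hV' : (0 : ℝ) < V := by exact_mod_cast hV
  have hk' : (0 : ℝ) < k := by exact_mod_cast hV.trans_le hk
  have hVk : (V : ℝ) / k ≤ 1 := by rw [div_le_one hk']; exact_mod_cast hk
  have h1 : ∑ j ∈ Finset.Iic V, (k.choose j : ℝ) * ((V : ℝ) / k) ^ V ≤ Real.exp 1 ^ V := by
    calc ∑ j ∈ Finset.Iic V, (k.choose j : ℝ) * ((V : ℝ) / k) ^ V
        ≤ ∑ j ∈ Finset.Iic V, (k.choose j : ℝ) * ((V : ℝ) / k) ^ j := by
          refine Finset.sum_le_sum fun j hj ↦ mul_le_mul_of_nonneg_left ?_ (by positivity)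
          exact pow_le_pow_of_le_one (by positivity) hVk (Finset.mem_Iic.1 hj)
      _ ≤ ∑ j ∈ Finset.range (k + 1), (k.choose j : ℝ) * ((V : ℝ) / k) ^ j := by
          refine Finset.sum_le_sum_of_subset_of_nonneg (fun j hj ↦ ?_) fun j _ _ ↦ by positivity
          simp at hj ⊢; omega
      _ = ((V : ℝ) / k + 1) ^ k := by
          rw [add_pow]; exact Finset.sum_congr rfl fun j _ ↦ by simp [mul_comm]
      _ ≤ Real.exp ((V : ℝ) / k) ^ k := by
          gcongr; exact Real.add_one_le_exp _
      _ = Real.exp 1 ^ V := by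
          rw [← Real.exp_nat_mul, ← Real.exp_nat_mul]; congr 1; field_simp
  rw [← Finset.sum_mul, div_pow] at h1
  rw [div_pow, mul_pow]
  rw [mul_div_assoc', div_le_iff₀ (by positivity)] at h1
  rw [le_div_iff₀ (by positivity)]
  exact h1

/-- The pull-back of a set family along a map. -/
def pullback (p : κ → ι) (F : Finset (Finset ι)) : Finset (Finset κ) :=
  F.image fun f ↦ Finset.univ.filter fun j ↦ p j ∈ f

lemma vcDim_pullback_le (p : κ → ι) (F : Finset (Finset ι)) :
    (pullback p F).vcDim ≤ F.vcDim := by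
  refine Finset.sup_le fun S hS ↦ ?_
  rw [Finset.mem_shatterer] at hS
  have hmem : ∀ t ⊆ S, ∃ f ∈ F, ∀ j ∈ S, (p j ∈ f ↔ j ∈ t) := by
    intro t ht
    obtain ⟨u, hu, hut⟩ := hS ht
    obtain ⟨f, hf, rfl⟩ := Finset.mem_image.1 hu
    refine ⟨f, hf, fun j hj ↦ ?_⟩
    rw [← hut]; simp [hj]
  -- A shattered set has its singletons as traces, and a pulled-back set cannot separate two indices
  -- with the same image under `p`.
  have hinj : Set.InjOn p S := by
    intro i hi j hj hij
    obtain ⟨f, -, hf⟩ := hmem {i} (by simpa using hi)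
    have h1 := (hf i hi).2 (by simp)
    rw [hij] at h1
    simpa [eq_comm] using (hf j hj).1 h1
  rw [← Finset.card_image_of_injOn hinj]
  apply Finset.Shatters.card_le_vcDim
  intro t ht
  obtain ⟨f, hf, hft⟩ := hmem (S.filter fun j ↦ p j ∈ t) (Finset.filter_subset _ _)
  refine ⟨f, hf, ?_⟩
  ext i
  constructor
  · intro hi
    obtain ⟨hi1, hi2⟩ := Finset.mem_inter.1 hi
    obtain ⟨j, hj, rfl⟩ := Finset.mem_image.1 hi1
    exact (Finset.mem_filter.1 ((hft j hj).1 hi2)).2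
  · intro hi
    obtain ⟨j, hj, rfl⟩ := Finset.mem_image.1 (ht hi)
    exact Finset.mem_inter.2 ⟨ht hi, (hft j hj).2 (Finset.mem_filter.2 ⟨hj, hi⟩)⟩

variable [Fintype ι]

lemma card_le_of_vcDim_le (F : Finset (Finset ι)) {V : ℕ} (hF : F.vcDim ≤ V) :
    F.card ≤ ∑ j ∈ Finset.Iic V, (Fintype.card ι).choose j :=
  (F.card_le_card_shatterer.trans Finset.card_shatterer_le_sum_vcDim).trans
    (Finset.sum_le_sum_of_subset (Finset.Iic_subset_Iic.2 hF))

/-- If the members of `F` are far apart, some tuple of `k` points distinguishes all of them. -/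
lemma exists_injOn_pullback [Nonempty ι] (F : Finset (Finset ι)) {e : ℝ}
    (hsep : ∀ f ∈ F, ∀ g ∈ F, f ≠ g → e * Fintype.card ι ≤ (symmDiff f g).card) {k : ℕ}
    (hk : (F.card : ℝ) ^ 2 * Real.exp (-(e * k)) < 1) :
    ∃ p : Fin k → ι, Set.InjOn (fun f : Finset ι ↦ Finset.univ.filter fun j ↦ p j ∈ f) F := by
  by_contra hcon
  push Not at hcon
  -- Union bound by counting: a tuple that confuses `f` and `g` avoids `symmDiff f g`, and at most
  -- `(n exp (-e)) ^ k` tuples do so for a given pair.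
  have hsub : (Finset.univ : Finset (Fin k → ι)) ⊆ F.offDiag.biUnion fun q ↦
      Fintype.piFinset fun _ ↦ (symmDiff q.1 q.2)ᶜ := by
    intro p _
    have := hcon p
    simp only [Set.InjOn, not_forall] at this
    obtain ⟨f, hf, g, hg, hfg, hne⟩ := this
    refine Finset.mem_biUnion.2 ⟨(f, g), Finset.mem_offDiag.2 ⟨hf, hg, hne⟩, ?_⟩
    refine Fintype.mem_piFinset.2 fun j ↦ ?_
    have hj := Finset.ext_iff.1 hfg j
    simp only [Finset.mem_filter, Finset.mem_univ, true_and] at hj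
    simp only [Finset.mem_compl, Finset.mem_symmDiff]
    tauto
  have hcard := (Finset.card_le_card hsub).trans Finset.card_biUnion_le
  simp only [Finset.card_univ, Fintype.card_pi, Finset.prod_const, Fintype.card_fin,
    Fintype.card_piFinset] at hcard
  set n := Fintype.card ι with hn
  have hbound : ∀ q ∈ F.offDiag, (((symmDiff q.1 q.2)ᶜ.card : ℝ)) ^ k
      ≤ n ^ k * Real.exp (-(e * k)) := by
    intro q hq
    obtain ⟨h1, h2, h3⟩ := Finset.mem_offDiag.1 hq
    have h4 := hsep _ h1 _ h2 h3
    have h5 : (((symmDiff q.1 q.2)ᶜ.card : ℝ)) ≤ n * Real.exp (-e) := by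
      rw [Finset.card_compl, Nat.cast_sub (Finset.card_le_univ _)]
      have := Real.add_one_le_exp (-e)
      have hn0 : (0 : ℝ) ≤ n := by positivity
      nlinarith
    calc (((symmDiff q.1 q.2)ᶜ.card : ℝ)) ^ k ≤ (n * Real.exp (-e)) ^ k := by gcongr
      _ = _ := by rw [mul_pow, ← Real.exp_nat_mul]; ring_nf
  have h1 : (n : ℝ) ^ k ≤ F.offDiag.card * (n ^ k * Real.exp (-(e * k))) := by
    calc (n : ℝ) ^ k ≤ ∑ q ∈ F.offDiag, (((symmDiff q.1 q.2)ᶜ.card : ℝ)) ^ k := by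
          exact_mod_cast hcard
      _ ≤ _ := by
          rw [← nsmul_eq_mul]
          exact Finset.sum_le_card_nsmul _ _ _ hbound
  have h2 : (F.offDiag.card : ℝ) ≤ (F.card : ℝ) ^ 2 := by
    rw [sq]
    have : F.offDiag.card ≤ F.card * F.card := by rw [Finset.offDiag_card]; omega
    exact_mod_cast this
  have hn0 : (0 : ℝ) < n ^ k := by
    have : 0 < n := Fintype.card_pos
    positivity
  have h3 : (F.offDiag.card : ℝ) * Real.exp (-(e * k)) < 1 :=
    (mul_le_mul_of_nonneg_right h2 (Real.exp_pos _).le).trans_lt hk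
  nlinarith

/-- Dudley's bound on the packing numbers of a family of bounded VC dimension. -/
lemma log_card_le_of_separated [Nonempty ι] (F : Finset (Finset ι)) {V : ℕ} (hV : 0 < V)
    (hF : F.vcDim ≤ V) {q : ℝ} (hq : 1 ≤ q)
    (hsep : ∀ f ∈ F, ∀ g ∈ F, f ≠ g → Fintype.card ι ≤ q ^ 2 * (symmDiff f g).card) :
    Real.log F.card ≤ 12 * V * q := by
  have hV1 : (1 : ℝ) ≤ V := by exact_mod_cast hV
  have hq0 : 0 < q := by linarith
  rcases Nat.eq_zero_or_pos F.card with h0 | hpos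
  · rw [h0]; simp; positivity
  have hm : (1 : ℝ) ≤ F.card := by exact_mod_cast hpos
  set m : ℝ := (F.card : ℝ) with hmdef
  have hL0 : 0 ≤ Real.log m := Real.log_nonneg hm
  -- The least `k` with `m² exp (-k / q²) < 1`. The traces on the `k` chosen points are still `m`
  -- distinct sets, so Sauer–Shelah bounds `m` by a power of its own logarithm.
  set k : ℕ := ⌊2 * Real.log m * q ^ 2⌋₊ + 1 with hkdef
  have hk1 : 2 * Real.log m * q ^ 2 < k := by
    rw [hkdef]; push_cast; exact Nat.lt_floor_add_one _
  have hk2 : (k : ℝ) ≤ 2 * Real.log m * q ^ 2 + 1 := by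
    rw [hkdef]; push_cast
    linarith [Nat.floor_le (show 0 ≤ 2 * Real.log m * q ^ 2 by positivity)]
  obtain ⟨p, hp⟩ := exists_injOn_pullback F (e := 1 / q ^ 2) (k := k)
    (fun f hf g hg hfg ↦ by
      have := hsep f hf g hg hfg
      rw [div_mul_eq_mul_div, one_mul, div_le_iff₀ (by positivity)]; linarith) (by
      have h1 : (F.card : ℝ) ^ 2 = Real.exp (2 * Real.log m) := by
        rw [mul_comm, Real.exp_mul, Real.exp_log (by linarith), ← hmdef]; norm_cast
      rw [h1, ← Real.exp_add, Real.exp_lt_one_iff]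
      have : 2 * Real.log m < 1 / q ^ 2 * k := by
        rw [div_mul_eq_mul_div, one_mul, lt_div_iff₀ (by positivity)]; exact hk1
      linarith)
  have hcardp : (pullback p F).card = F.card := Finset.card_image_of_injOn hp
  have hvc : (pullback p F).vcDim ≤ V := (vcDim_pullback_le p F).trans hF
  rcases le_or_gt k V with hkV | hkV
  · have h1 : F.card ≤ 2 ^ V := by
      rw [← hcardp]
      refine (Finset.card_le_univ _).trans ?_
      simp only [Fintype.card_finset, Fintype.card_fin]
      exact Nat.pow_le_pow_right (by norm_num) hkV
    have h2 : m ≤ 2 ^ V := by rw [hmdef]; exact_mod_cast h1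
    have h3 : Real.log m ≤ V * Real.log 2 := by
      rw [← Real.log_pow]; exact Real.log_le_log (by linarith) h2
    have h4 := Real.log_two_lt_d9
    nlinarith
  · have h1 : m ≤ (Real.exp 1 * k / V) ^ V := by
      refine le_trans ?_ (sum_choose_le_pow hV hkV.le)
      have := card_le_of_vcDim_le _ hvc
      rw [hcardp, Fintype.card_fin] at this
      rw [hmdef]; exact_mod_cast this
    set l : ℝ := Real.log m / V with hl
    have hlm : Real.log m = l * V := by rw [hl]; field_simp
    have h2 : Real.exp l ≤ Real.exp 1 * k / V := by
      rw [← pow_le_pow_iff_left₀ (Real.exp_pos _).le (by positivity) hV.ne', ← Real.exp_nat_mul,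
        mul_comm, ← hlm, Real.exp_log (by linarith)]
      exact h1
    by_contra hcon
    push Not at hcon
    have hlq : 12 * q < l := by
      rw [hlm] at hcon
      have : (12 * q) * V < l * V := by linarith
      exact lt_of_mul_lt_mul_right this (by positivity)
    have h3 : (k : ℝ) / V ≤ 2 * l * q ^ 2 + 1 := by
      rw [div_le_iff₀ (by positivity)]
      rw [hlm] at hk2
      nlinarith
    have h4 : Real.exp l ≤ Real.exp 1 * (2 * l * q ^ 2 + 1) := by
      refine h2.trans ?_
      rw [mul_div_assoc]
      gcongr
    -- If `l > 12 q`, then `exp l ≥ l³ / 6` beats `e (2 l q² + 1)`. An entropy bound linear in `q`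
    -- is cruder than the logarithmic one, but still summable in the chaining.
    have h5 := Real.pow_div_factorial_le_exp l (by linarith) 3
    have h6 := Real.exp_one_lt_d9
    have h7 : q ^ 2 ≤ l ^ 2 / 144 := by nlinarith
    have h8 : 2 * l * q ^ 2 + 1 ≤ l ^ 3 / 24 := by
      have : 2 * l * q ^ 2 ≤ 2 * l * (l ^ 2 / 144) := by gcongr
      have h12 : 12 ≤ l := by linarith
      have : (12 : ℝ) ^ 3 ≤ l ^ 3 := by gcongr
      nlinarith
    have h9 : Real.exp 1 * (2 * l * q ^ 2 + 1) ≤ 3 * (l ^ 3 / 24) := by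
      gcongr; linarith
    have h10 : ((3 : ℕ).factorial : ℝ) = 6 := by norm_num [Nat.factorial]
    rw [h10] at h5
    have : 0 < l ^ 3 := by
      have : 0 < l := by linarith
      positivity
    linarith

/-- A separated subfamily of maximal cardinality is a net, since otherwise it could be enlarged. -/
lemma exists_separated_net (F : Finset (Finset ι)) (hF : F.Nonempty) {r : ℝ} (hr : 0 ≤ r) :
    ∃ A ⊆ F, A.Nonempty ∧ (∀ f ∈ A, ∀ g ∈ A, f ≠ g → r < (symmDiff f g).card) ∧
      ∀ f ∈ F, ∃ g ∈ A, ((symmDiff f g).card : ℝ) ≤ r := by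
  classical
  obtain ⟨A, hA, hmax⟩ := Finset.exists_max_image
    (F.powerset.filter fun A ↦ ∀ f ∈ A, ∀ g ∈ A, f ≠ g → r < (symmDiff f g).card) Finset.card
    ⟨∅, by simp⟩
  rw [Finset.mem_filter, Finset.mem_powerset] at hA
  have hnet : ∀ f ∈ F, ∃ g ∈ A, ((symmDiff f g).card : ℝ) ≤ r := by
    intro f hf
    by_contra hcon
    push Not at hcon
    have hfA : f ∉ A := fun h ↦ by
      have := hcon f h
      simp at this; linarith
    have h1 := hmax (insert f A) (by
      rw [Finset.mem_filter, Finset.mem_powerset]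
      refine ⟨Finset.insert_subset hf hA.1, fun a ha b hb hab ↦ ?_⟩
      rcases Finset.mem_insert.1 ha with rfl | ha' <;>
        rcases Finset.mem_insert.1 hb with rfl | hb'
      · exact absurd rfl hab
      · exact hcon b hb'
      · rw [symmDiff_comm]; exact hcon a ha'
      · exact hA.2 a ha' b hb' hab)
    rw [Finset.card_insert_of_notMem hfA] at h1
    omega
  refine ⟨A, hA.1, ?_, hA.2, hnet⟩
  obtain ⟨f, hf⟩ := hF
  obtain ⟨g, hg, -⟩ := hnet f hf
  exact ⟨g, hg⟩

/-- The Rademacher complexity of a family of VC dimension `V` on `n` points is `O(√(V n))`. -/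
theorem rademacherSup_le_of_vcDim_le [Nonempty ι] (F : Finset (Finset ι)) (hF : F.Nonempty)
    {V : ℕ} (hV : 0 < V) (hvc : F.vcDim ≤ V) :
    rademacherSup F hF indicatorVec ≤ 23 * Real.sqrt (V * Fintype.card ι) := by
  set n : ℝ := (Fintype.card ι : ℝ) with hn
  have hn0 : 0 < n := by rw [hn]; exact_mod_cast Fintype.card_pos
  have hV1 : (1 : ℝ) ≤ V := by exact_mod_cast hV
  have hlog2 := Real.log_two_lt_d9
  -- Chaining over the scales `n / 16 ^ k` of the symmetric difference, which are squared `ℓ²`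
  -- distances. The entropy at level `k + 1` is of order `V 4 ^ (k + 1)`, so the step costs order
  -- `√(V n) / 2 ^ k`, a geometric series. At `k = 0` separation leaves a single set.
  have main : ∀ k : ℕ, ∀ A ⊆ F, ∀ hA : A.Nonempty,
      (∀ f ∈ A, ∀ g ∈ A, f ≠ g → n / 16 ^ k < (symmDiff f g).card) →
      rademacherSup A hA indicatorVec ≤ Real.sqrt (V * n) * (2 + 21 * (1 - 1 / 2 ^ k)) := by
    intro k
    induction k with
    | zero =>
      intro A hAF hA hsep
      have hcard : A.card = 1 := by
        refine le_antisymm (Finset.card_le_one.2 fun f hf g hg ↦ ?_) hA.card_pos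
        by_contra hne
        have h1 := hsep f hf g hg hne
        have h2 : ((symmDiff f g).card : ℝ) ≤ n := by
          rw [hn]; exact_mod_cast Finset.card_le_univ _
        simp at h1; linarith
      have h := rademacherSup_le A hA indicatorVec (S := n) (L := 1) hn0
        (fun f _ ↦ sum_sq_indicatorVec_le f) one_pos (by rw [hcard]; norm_num; linarith)
      refine h.trans ?_
      have : Real.sqrt (2 * n * 1) ≤ Real.sqrt (4 * (V * n)) := by
        apply Real.sqrt_le_sqrt; nlinarith
      rw [Real.sqrt_mul (show (0 : ℝ) ≤ 4 by norm_num), show Real.sqrt 4 = 2 by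
        rw [show (4 : ℝ) = 2 ^ 2 by norm_num]; exact Real.sqrt_sq (by norm_num)] at this
      simp only [pow_zero]
      linarith
    | succ k ih =>
      intro A hAF hA hsep
      obtain ⟨A', hA'F, hA', hsep', hnet⟩ := exists_separated_net F hF (r := n / 16 ^ k)
        (by positivity)
      have h1 := ih A' hA'F hA' hsep'
      have hlog : Real.log A.card ≤ 12 * V * 4 ^ (k + 1) := by
        refine log_card_le_of_separated A hV ((Finset.vcDim_mono hAF).trans hvc)
          (one_le_pow₀ (by norm_num)) fun f hf g hg hfg ↦ ?_
        have h2 := (hsep f hf g hg hfg).le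
        rw [div_le_iff₀ (by positivity)] at h2
        rw [← pow_mul, mul_comm (k + 1) 2, pow_mul]
        norm_num
        linarith
      have hc : (0 : ℝ) < A.card := by exact_mod_cast hA.card_pos
      have h4 : (1 : ℝ) ≤ 4 ^ (k + 1) := one_le_pow₀ (by norm_num)
      have h2 := rademacherSup_le_add A' A hA' hA (r := n / 16 ^ k) (L := 13 * V * 4 ^ (k + 1))
        (by positivity) (by positivity) (by
          rw [Real.log_mul (by norm_num) hc.ne']
          nlinarith) (fun f hf ↦ hnet f (hAF hf))
      have h3 : Real.sqrt (2 * (n / 16 ^ k) * (13 * V * 4 ^ (k + 1)))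
          ≤ Real.sqrt (V * n) * (21 / 2 / 2 ^ k) := by
        rw [← Real.sqrt_sq (show (0 : ℝ) ≤ 21 / 2 / 2 ^ k by positivity),
          ← Real.sqrt_mul (by positivity)]
        apply Real.sqrt_le_sqrt
        have e1 : (2 : ℝ) * (n / 16 ^ k) * (13 * V * 4 ^ (k + 1)) = 104 * (V * n) / 4 ^ k := by
          rw [show (16 : ℝ) ^ k = 4 ^ k * 4 ^ k by rw [← mul_pow]; norm_num]
          field_simp; ring
        have e2 : V * n * (21 / 2 / 2 ^ k : ℝ) ^ 2 = 110.25 * (V * n) / 4 ^ k := by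
          rw [show (4 : ℝ) ^ k = (2 ^ k) ^ 2 by rw [← pow_mul, mul_comm, pow_mul]; norm_num]
          field_simp; ring
        rw [e1, e2]
        gcongr
        norm_num
      have e3 : Real.sqrt (V * n) * (2 + 21 * (1 - 1 / 2 ^ k)) +
          Real.sqrt (V * n) * (21 / 2 / 2 ^ k)
          = Real.sqrt (V * n) * (2 + 21 * (1 - 1 / 2 ^ (k + 1))) := by
        rw [pow_succ]; field_simp; ring
      linarith
  -- At level `n` the scale `n / 16 ^ n` is below `1`, so `F` itself is separated.
  have hfin := main (Fintype.card ι) F subset_rfl hF (fun f hf g hg hfg ↦ by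
    have h1 : (1 : ℝ) ≤ (symmDiff f g).card := by
      have : (symmDiff f g).Nonempty := by
        rw [Finset.nonempty_iff_ne_empty]
        exact fun h ↦ hfg (symmDiff_eq_bot.1 h)
      exact_mod_cast this.card_pos
    refine lt_of_lt_of_le ?_ h1
    rw [div_lt_one (by positivity), hn]
    exact_mod_cast Nat.lt_pow_self (by norm_num))
  refine hfin.trans ?_
  have h5 : (0 : ℝ) ≤ 1 / 2 ^ Fintype.card ι := by positivity
  have h6 := Real.sqrt_nonneg (V * n)
  nlinarith

end VC

/-! ### VC dimension of half-spaces. -/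

section Halfspace

variable {ι E : Type*} [Fintype ι] [DecidableEq ι] [NormedAddCommGroup E] [InnerProductSpace ℝ E]
  [FiniteDimensional ℝ E]

open Classical in
/-- The set of indices of the points `x i` in the half-space `⟪v, ·⟫ ≥ s`. -/
noncomputable def halfspacePattern (x : ι → E) (s : ℝ) (v : E) : Finset ι :=
  Finset.univ.filter fun i ↦ s ≤ inner ℝ v (x i)

/-- Among more than `dim E + 1` points, Radon's theorem finds two complementary parts with
intersecting convex hulls. No half-space can hold exactly one of them, so the points are not
shattered. -/
lemma vcDim_halfspacePattern_le (x : ι → E) (s : ℝ) (T : Finset E) :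
    (T.image (halfspacePattern x s)).vcDim ≤ Module.finrank ℝ E + 1 := by
  refine Finset.sup_le fun S hS ↦ ?_
  rw [Finset.mem_shatterer] at hS
  by_contra hcon
  have hdep : ¬ AffineIndependent ℝ (fun i : S ↦ x i) := fun h ↦ by
    have := h.card_le_finrank_succ
    rw [Fintype.card_coe] at this
    have h2 := Submodule.finrank_le (vectorSpan ℝ (Set.range fun i : S ↦ x i))
    omega
  obtain ⟨J, y, hy1, hy2⟩ := Convex.radon_partition hdep
  classical
  obtain ⟨u, hu, hut⟩ := hS (t := S.filter fun i ↦ ∃ h : i ∈ S, (⟨i, h⟩ : S) ∈ J)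
    (Finset.filter_subset _ _)
  obtain ⟨v, -, rfl⟩ := Finset.mem_image.1 hu
  have hmem : ∀ i : S, s ≤ inner ℝ v (x i) ↔ i ∈ J := by
    intro i
    have := Finset.ext_iff.1 hut i
    simpa [halfspacePattern] using this
  have hc1 : convexHull ℝ ((fun i : S ↦ x i) '' J) ⊆ {z | s ≤ inner ℝ v z} := by
    refine convexHull_min ?_ (convex_halfSpace_ge (innerSL ℝ v).toLinearMap.isLinear s)
    rintro _ ⟨i, hi, rfl⟩
    exact (hmem i).2 hi
  have hc2 : convexHull ℝ ((fun i : S ↦ x i) '' Jᶜ) ⊆ {z | inner ℝ v z < s} := by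
    refine convexHull_min ?_ (convex_halfSpace_lt (innerSL ℝ v).toLinearMap.isLinear s)
    rintro _ ⟨i, hi, rfl⟩
    exact not_le.1 fun h ↦ hi ((hmem i).1 h)
  have h1 := hc1 hy1
  have h2 := hc2 hy2
  simp only [Set.mem_ofPred_eq] at h1 h2
  linarith

end Halfspace

/-! ### Symmetrization with a ghost sample. -/

section Symmetrization

variable {ι E : Type*} [Fintype ι] [MeasurableSpace E]

/-- Exchange the `i`-th coordinates of two samples whenever `ε i` is false. -/
def swapCoords (ε : ι → Bool) (q : (ι → E) × (ι → E)) : (ι → E) × (ι → E) :=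
  (fun i ↦ if ε i then q.1 i else q.2 i, fun i ↦ if ε i then q.2 i else q.1 i)

lemma measurePreserving_swapCoords (P : Measure E) [IsProbabilityMeasure P] (ε : ι → Bool) :
    MeasurePreserving (swapCoords ε)
      ((Measure.pi fun _ : ι ↦ P).prod (Measure.pi fun _ : ι ↦ P))
      ((Measure.pi fun _ : ι ↦ P).prod (Measure.pi fun _ : ι ↦ P)) := by
  have h1 := measurePreserving_arrowProdEquivProdArrow E E ι (fun _ ↦ P) (fun _ ↦ P)
  have h2 : MeasurePreserving (fun (q : ι → E × E) i ↦ (if ε i then id else Prod.swap) (q i))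
      (Measure.pi fun _ : ι ↦ P.prod P) (Measure.pi fun _ : ι ↦ P.prod P) := by
    refine measurePreserving_pi _ _ fun i ↦ ?_
    split_ifs
    · exact MeasurePreserving.id _
    · exact Measure.measurePreserving_swap
  have h3 := (h1.comp h2).comp (h1.symm _)
  convert! h3 using 1
  ext q i <;> by_cases h : ε i <;>
    simp [swapCoords, h, MeasurableEquiv.arrowProdEquivProdArrow, Equiv.arrowProdEquivProdArrow]

variable {τ : Type*}

/-- The symmetrization inequality, for a finite class of bounded functions. -/
lemma integral_sup_deviation_le [DecidableEq ι] (P : Measure E) [IsProbabilityMeasure P]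
    (T : Finset τ) (hT : T.Nonempty) (φ : τ → E → ℝ) (hφ : ∀ t, Measurable (φ t))
    (hφ1 : ∀ t x, |φ t x| ≤ 1) {R : ℝ}
    (hR : ∀ x : ι → E, rademacherSup T hT (fun t i ↦ φ t (x i)) ≤ R) :
    ∫ x, T.sup' hT (fun t ↦ |∑ i, φ t (x i) - Fintype.card ι * ∫ y, φ t y ∂P|)
      ∂(Measure.pi fun _ : ι ↦ P) ≤ 2 * R := by
  set m := Measure.pi fun _ : ι ↦ P with hm
  set G : (ι → Bool) → (ι → E) × (ι → E) → ℝ := fun ε q ↦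
    T.sup' hT fun t ↦ |signedSum ε fun i ↦ φ t (q.1 i) - φ t (q.2 i)| with hG
  have hGm : ∀ ε, Measurable (G ε) := by
    intro ε
    have := Finset.measurable_sup' hT
      (f := fun t (q : (ι → E) × (ι → E)) ↦ |signedSum ε fun i ↦ φ t (q.1 i) - φ t (q.2 i)|)
      (fun t _ ↦ by
        have := hφ t
        unfold signedSum
        fun_prop)
    convert! this using 1
    ext q
    simp [hG, Finset.sup'_apply]
  have habs : ∀ ε t (q : (ι → E) × (ι → E)),
      |signedSum ε fun i ↦ φ t (q.1 i) - φ t (q.2 i)| ≤ 2 * Fintype.card ι := by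
    intro ε t q
    refine (Finset.abs_sum_le_sum_abs _ _).trans ?_
    calc _ ≤ ∑ _i : ι, (2 : ℝ) := by
          refine Finset.sum_le_sum fun i _ ↦ ?_
          rw [abs_mul]
          have h1 : |(if ε i then (1 : ℝ) else -1)| = 1 := by split_ifs <;> simp
          rw [h1, one_mul]
          have := abs_sub (φ t (q.1 i)) (φ t (q.2 i))
          linarith [hφ1 t (q.1 i), hφ1 t (q.2 i)]
      _ = _ := by simp [mul_comm]
  have hG0 : ∀ ε q, 0 ≤ G ε q := by
    intro ε q
    obtain ⟨t, ht⟩ := hT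
    exact (abs_nonneg _).trans (Finset.le_sup' (fun t ↦ |signedSum ε fun i ↦
      φ t (q.1 i) - φ t (q.2 i)|) ht)
  have hGb : ∀ ε q, ‖G ε q‖ ≤ 2 * Fintype.card ι := by
    intro ε q
    rw [Real.norm_of_nonneg (hG0 ε q)]
    exact Finset.sup'_le _ _ fun t _ ↦ habs ε t q
  have hGi : ∀ ε, Integrable (G ε) (m.prod m) := fun ε ↦
    Integrable.of_bound (hGm ε).aestronglyMeasurable _ (ae_of_all _ (hGb ε))
  have hGi' : ∀ ε x, Integrable (fun y ↦ G ε (x, y)) m := fun ε x ↦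
    Integrable.of_bound ((hGm ε).comp measurable_prodMk_left).aestronglyMeasurable _
      (ae_of_all _ fun y ↦ hGb ε (x, y))
  have hφi : ∀ t i, Integrable (fun y : ι → E ↦ φ t (y i)) m := fun t i ↦
    Integrable.of_bound ((hφ t).comp (measurable_pi_apply i)).aestronglyMeasurable 1
      (ae_of_all _ fun y ↦ hφ1 t (y i))
  set tt : ι → Bool := fun _ ↦ true with htt
  -- The mean is replaced by the average over a ghost sample `y`, and the supremum of an average is
  -- at most the average of the supremum.
  have hfiber : ∀ x, T.sup' hT (fun t ↦ |∑ i, φ t (x i) - Fintype.card ι * ∫ y, φ t y ∂P|)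
      ≤ ∫ y, G tt (x, y) ∂m := by
    intro x
    refine Finset.sup'_le _ _ fun t ht ↦ ?_
    have h1 : ∑ i, φ t (x i) - Fintype.card ι * ∫ y, φ t y ∂P
        = ∫ y, (signedSum tt fun i ↦ φ t (x i) - φ t (y i)) ∂m := by
      simp only [signedSum, htt, if_true, one_mul]
      rw [integral_finsetSum (f := fun i (y : ι → E) ↦ φ t (x i) - φ t (y i)) _
        fun i _ ↦ (integrable_const _).sub (hφi t i)]
      simp_rw [integral_sub (integrable_const _) (hφi t _)]
      rw [Finset.sum_sub_distrib]
      congr 1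
      · simp
      · rw [Finset.sum_congr rfl fun i _ ↦
          integral_comp_eval (μ := fun _ : ι ↦ P) (i := i) (hφ t).aestronglyMeasurable]
        simp
    rw [h1]
    refine (abs_integral_le_integral_abs).trans ?_
    refine integral_mono_of_nonneg (ae_of_all _ fun y ↦ abs_nonneg _) (hGi' tt x)
      (ae_of_all _ fun y ↦ ?_)
    exact Finset.le_sup' (fun t ↦ |signedSum tt fun i ↦ φ t (x i) - φ t (y i)|) ht
  -- Flipping the `i`-th sign amounts to exchanging `x i` and `y i`, which preserves the joint law;
  -- so signs may be averaged in for free.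
  have hswap : ∀ ε, ∫ q, G ε q ∂(m.prod m) = ∫ q, G tt q ∂(m.prod m) := by
    intro ε
    have hmp := measurePreserving_swapCoords (ι := ι) P ε
    rw [← hm] at hmp
    conv_rhs => rw [← hmp.map_eq]
    rw [integral_map hmp.measurable.aemeasurable (hGm tt).aestronglyMeasurable]
    congr 1
    ext q
    simp only [hG, swapCoords, signedSum, htt]
    congr 1
    ext t
    congr 1
    refine Finset.sum_congr rfl fun i _ ↦ ?_
    by_cases h : ε i <;> simp [h]
  have haverage : ∫ q, signAverage (fun ε ↦ G ε q) ∂(m.prod m) = ∫ q, G tt q ∂(m.prod m) := by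
    simp only [signAverage]
    rw [integral_div, integral_finsetSum _ fun ε _ ↦ hGi ε, Finset.sum_congr rfl fun ε _ ↦ hswap ε]
    simp
  have hrad : ∀ q, signAverage (fun ε ↦ G ε q) ≤ 2 * R := by
    intro q
    have h1 := hR q.1
    have h2 := hR q.2
    have h3 : signAverage (fun ε ↦ G ε q) ≤ rademacherSup T hT (fun t i ↦ φ t (q.1 i)) +
        rademacherSup T hT (fun t i ↦ φ t (q.2 i)) := by
      rw [rademacherSup, rademacherSup, ← signAverage_add]
      refine signAverage_mono fun ε ↦ Finset.sup'_le _ _ fun t ht ↦ ?_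
      rw [signedSum_sub]
      refine (abs_sub _ _).trans (add_le_add ?_ ?_)
      · exact Finset.le_sup' (fun t ↦ |signedSum ε fun i ↦ φ t (q.1 i)|) ht
      · exact Finset.le_sup' (fun t ↦ |signedSum ε fun i ↦ φ t (q.2 i)|) ht
    linarith
  calc _ ≤ ∫ x, ∫ y, G tt (x, y) ∂m ∂m := by
        refine integral_mono_of_nonneg (ae_of_all _ fun x ↦ ?_) (hGi tt).integral_prod_left
          (ae_of_all _ hfiber)
        obtain ⟨t, ht⟩ := hT
        exact (abs_nonneg _).trans
          (Finset.le_sup' (fun t ↦ |∑ i, φ t (x i) - Fintype.card ι * ∫ y, φ t y ∂P|) ht)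
    _ = ∫ q, G tt q ∂(m.prod m) := (integral_prod _ (hGi tt)).symm
    _ = ∫ q, signAverage (fun ε ↦ G ε q) ∂(m.prod m) := haverage.symm
    _ ≤ ∫ _q, 2 * R ∂(m.prod m) := by
        refine integral_mono_of_nonneg (ae_of_all _ fun q ↦ ?_) (integrable_const _)
          (ae_of_all _ hrad)
        simp only [signAverage]
        exact div_nonneg (Finset.sum_nonneg fun ε _ ↦ hG0 ε q) (by positivity)
    _ = 2 * R := by simp

end Symmetrization

/-! ### Uniform lower bounds on half-space counts. -/

section UniformDeviation

variable {ι E : Type*} [Fintype ι] [NormedAddCommGroup E] [InnerProductSpace ℝ E]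

/-- Holding at least `a` points is a finite union, over index sets, of closed conditions. Joint
closedness in data and direction yields measurability, and also reduces all directions to a dense
sequence. -/
lemma isClosed_card_halfspacePattern_ge (μ : E) (s a : ℝ) :
    IsClosed {q : (ι → E) × E | a ≤ (halfspacePattern (fun i ↦ q.1 i - μ) s q.2).card} := by
  classical
  have : {q : (ι → E) × E | a ≤ (halfspacePattern (fun i ↦ q.1 i - μ) s q.2).card}
      = ⋃ T ∈ {T : Finset ι | a ≤ T.card}, ⋂ i ∈ T, {q | s ≤ inner ℝ q.2 (q.1 i - μ)} := by
    ext q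
    simp only [Set.mem_ofPred_eq, Set.mem_iUnion, Set.mem_iInter, exists_prop]
    constructor
    · intro h
      exact ⟨_, h, fun i hi ↦ by simpa [halfspacePattern] using hi⟩
    · rintro ⟨T, hT, h⟩
      refine hT.trans ?_
      exact_mod_cast Finset.card_le_card fun i hi ↦ by simpa [halfspacePattern] using h i hi
  rw [this]
  refine Set.Finite.isClosed_biUnion (Set.toFinite _) fun T _ ↦ isClosed_biInter fun i _ ↦ ?_
  exact isClosed_le continuous_const (by fun_prop)

/-- The datasets such that every half-space at signed distance `s` from `μ` holds at least `a`
points. -/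
def uniformlyDeep (ι : Type*) [Fintype ι] (μ : E) (s a : ℝ) : Set (ι → E) :=
  {x | ∀ v : E, ‖v‖ = 1 → a ≤ (halfspacePattern (fun i ↦ x i - μ) s v).card}

lemma isClosed_uniformlyDeep (μ : E) (s a : ℝ) : IsClosed (uniformlyDeep ι μ s a) := by
  have : uniformlyDeep ι μ s a = ⋂ (v : E) (_ : ‖v‖ = 1),
      (fun x ↦ (x, v)) ⁻¹' {q : (ι → E) × E |
        a ≤ (halfspacePattern (fun i ↦ q.1 i - μ) s q.2).card} := by
    ext x; simp [uniformlyDeep]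
  rw [this]
  exact isClosed_iInter fun v ↦ isClosed_iInter fun _ ↦
    (isClosed_card_halfspacePattern_ge μ s a).preimage (by fun_prop)

variable [FiniteDimensional ℝ E] [MeasurableSpace E] [BorelSpace E]

/-- A finite class of half-spaces deviates from its expected counts by `O(√((d + 1) N))`. -/
lemma measure_exists_card_halfspacePattern_lt_le [Nonempty ι] (P : Measure E)
    [IsProbabilityMeasure P] (μ : E) (s p : ℝ) (u : ℕ → E)
    (hp : ∀ k, P.real {x | s ≤ inner ℝ (u k) (x - μ)} = p) {e : ℝ} (he : 0 < e) (m : ℕ) :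
    (Measure.pi fun _ : ι ↦ P) {x | ∃ k ≤ m,
        ((halfspacePattern (fun i ↦ x i - μ) s (u k)).card : ℝ) < Fintype.card ι * p - e}
      ≤ ENNReal.ofReal (46 * Real.sqrt ((Module.finrank ℝ E + 1 : ℕ) * Fintype.card ι) / e) := by
  classical
  set B : ℝ := Real.sqrt ((Module.finrank ℝ E + 1 : ℕ) * Fintype.card ι) with hB
  set A : ℕ → Set E := fun k ↦ {x | s ≤ inner ℝ (u k) (x - μ)} with hA
  have hAm : ∀ k, MeasurableSet (A k) := fun k ↦
    (isClosed_le continuous_const (by fun_prop)).measurableSet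
  set φ : ℕ → E → ℝ := fun k ↦ (A k).indicator fun _ ↦ 1 with hφ
  have hφm : ∀ k, Measurable (φ k) := fun k ↦ measurable_const.indicator (hAm k)
  have hφ1 : ∀ k x, |φ k x| ≤ 1 := by
    intro k x
    simp only [hφ, Set.indicator]
    split_ifs <;> simp
  have hφp : ∀ k, ∫ y, φ k y ∂P = p := by
    intro k
    rw [← hp k]
    simp only [hφ]
    rw [integral_indicator_const _ (hAm k)]
    simp [hA]
  have hpat : ∀ (x : ι → E) k, (fun i ↦ φ k (x i))
      = indicatorVec (halfspacePattern (fun i ↦ x i - μ) s (u k)) := by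
    intro x k
    ext i
    simp [hφ, hA, indicatorVec, halfspacePattern, Set.indicator]
  set T := Finset.range (m + 1) with hT
  have hTn : T.Nonempty := Finset.nonempty_range_add_one
  have hR : ∀ x : ι → E, rademacherSup T hTn (fun t i ↦ φ t (x i)) ≤ 23 * B := by
    intro x
    have hF : ((T.image u).image (halfspacePattern (fun i ↦ x i - μ) s)).Nonempty :=
      (hTn.image _).image _
    refine le_trans ?_ (rademacherSup_le_of_vcDim_le _ hF (Nat.succ_pos _)
      (vcDim_halfspacePattern_le (fun i ↦ x i - μ) s (T.image u)))
    refine signAverage_mono fun ε ↦ Finset.sup'_le _ _ fun k hk ↦ ?_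
    simp only [hpat]
    exact Finset.le_sup' (fun f ↦ |signedSum ε (indicatorVec f)|)
      (Finset.mem_image_of_mem _ (Finset.mem_image_of_mem _ hk))
  have hint := integral_sup_deviation_le P T hTn φ hφm hφ1 hR
  simp only [hφp] at hint
  set D : (ι → E) → ℝ := fun x ↦ T.sup' hTn fun t ↦ |∑ i, φ t (x i) - Fintype.card ι * p| with hD
  have hD0 : ∀ x, 0 ≤ D x := by
    intro x
    obtain ⟨t, ht⟩ := hTn
    exact (abs_nonneg _).trans
      (Finset.le_sup' (fun t ↦ |∑ i, φ t (x i) - Fintype.card ι * p|) ht)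
  have hDm : Measurable D := by
    have := Finset.measurable_sup' hTn
      (f := fun t (x : ι → E) ↦ |∑ i, φ t (x i) - Fintype.card ι * p|)
      (fun t _ ↦ by have := hφm t; fun_prop)
    convert! this using 1
    ext x
    simp [hD, Finset.sup'_apply]
  have hDi : Integrable D (Measure.pi fun _ : ι ↦ P) := by
    refine Integrable.of_bound hDm.aestronglyMeasurable
      (Fintype.card ι + |Fintype.card ι * p|) (ae_of_all _ fun x ↦ ?_)
    rw [Real.norm_of_nonneg (hD0 x)]
    refine Finset.sup'_le _ _ fun t _ ↦ (abs_sub _ _).trans ?_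
    gcongr
    refine (Finset.abs_sum_le_sum_abs _ _).trans ?_
    calc _ ≤ ∑ _i : ι, (1 : ℝ) := Finset.sum_le_sum fun i _ ↦ hφ1 t (x i)
      _ = _ := by simp
  have hmark := mul_meas_ge_le_integral_of_nonneg (ae_of_all _ hD0) hDi e
  have hreal : (Measure.pi fun _ : ι ↦ P).real {x | e ≤ D x} ≤ 46 * B / e := by
    rw [le_div_iff₀ he]
    linarith
  rw [← ENNReal.ofReal_toReal (measure_ne_top (Measure.pi fun _ : ι ↦ P) _)]
  refine ENNReal.ofReal_le_ofReal (le_trans ?_ hreal)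
  refine ENNReal.toReal_mono (measure_ne_top _ _) (measure_mono ?_)
  rintro x ⟨k, hk, hlt⟩
  have hsum : ∑ i, φ k (x i) = (halfspacePattern (fun i ↦ x i - μ) s (u k)).card := by
    calc ∑ i, φ k (x i) = ∑ i, indicatorVec (halfspacePattern (fun i ↦ x i - μ) s (u k)) i :=
          Finset.sum_congr rfl fun i _ ↦ congrFun (hpat x k) i
      _ = _ := by simp [indicatorVec]
  have h1 := Finset.le_sup' (fun t ↦ |∑ i, φ t (x i) - Fintype.card ι * p|)
    (show k ∈ T by rw [hT, Finset.mem_range]; omega)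
  simp only [Set.mem_ofPred_eq]
  refine le_trans ?_ h1
  simp only [hsum]
  rw [abs_sub_comm]
  refine le_trans ?_ (le_abs_self _)
  linarith

/-- The bound for the first `m + 1` directions of a dense sequence does not depend on `m`, so it
survives the increasing union; closedness then covers every direction. -/
lemma measure_compl_uniformlyDeep_le [Nonempty ι] [Nontrivial E] (P : Measure E)
    [IsProbabilityMeasure P] (μ : E) (s p : ℝ)
    (hp : ∀ v : E, ‖v‖ = 1 → P.real {x | s ≤ inner ℝ v (x - μ)} = p) {e : ℝ} (he : 0 < e) :
    (Measure.pi fun _ : ι ↦ P) (uniformlyDeep ι μ s (Fintype.card ι * p - e))ᶜ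
      ≤ ENNReal.ofReal (46 * Real.sqrt ((Module.finrank ℝ E + 1 : ℕ) * Fintype.card ι) / e) := by
  have : Nonempty (Metric.sphere (0 : E) 1) :=
    (NormedSpace.sphere_nonempty.2 zero_le_one).to_subtype
  set u : ℕ → Metric.sphere (0 : E) 1 := TopologicalSpace.denseSeq _ with hu
  have hu1 : ∀ k, ‖(u k : E)‖ = 1 := fun k ↦ by simp
  set a := Fintype.card ι * p - e with ha
  set U : ℕ → Set (ι → E) := fun m ↦ {x | ∃ k ≤ m,
        ((halfspacePattern (fun i ↦ x i - μ) s (u k)).card : ℝ) < a} with hU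
  have hmono : Monotone U := fun m m' hm x ⟨k, hk, h⟩ ↦ ⟨k, hk.trans hm, h⟩
  have hsub : (uniformlyDeep ι μ s a)ᶜ ⊆ ⋃ m, U m := by
    intro x hx
    by_contra hcon
    simp only [hU, Set.mem_iUnion, Set.mem_ofPred_eq, not_exists, not_and, not_lt] at hcon
    refine hx fun v hv ↦ ?_
    have hcl : IsClosed {v : Metric.sphere (0 : E) 1 |
        a ≤ (halfspacePattern (fun i ↦ x i - μ) s (v : E)).card} :=
      (isClosed_card_halfspacePattern_ge (ι := ι) μ s a).preimage
        (f := fun v : Metric.sphere (0 : E) 1 ↦ (x, (v : E))) (by fun_prop)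
    have hd := (TopologicalSpace.denseRange_denseSeq (Metric.sphere (0 : E) 1)).closure_eq
    have := hcl.closure_subset_iff.2 (show Set.range u ⊆ _ by
      rintro _ ⟨k, rfl⟩
      exact hcon k k le_rfl)
    rw [hd] at this
    exact this (Set.mem_univ (⟨v, by simpa using hv⟩ : Metric.sphere (0 : E) 1))
  refine (measure_mono hsub).trans ?_
  rw [hmono.measure_iUnion]
  exact iSup_le fun m ↦ measure_exists_card_halfspacePattern_lt_le P μ s p (fun k ↦ (u k : E))
    (fun k ↦ hp _ (hu1 k)) he m

end UniformDeviation

/-! ### Gaussian mass of half-spaces. -/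

section GaussianTail

lemma half_le_gaussianReal_Ici_zero : 1 / 2 ≤ (gaussianReal 0 1).real (Set.Ici 0) := by
  have h1 : (gaussianReal 0 1).real (Set.Iic 0) = (gaussianReal 0 1).real (Set.Ici 0) := by
    have := gaussianReal_map_neg (μ := 0) (v := 1)
    rw [neg_zero] at this
    conv_lhs => rw [← this]
    rw [map_measureReal_apply (by fun_prop) measurableSet_Iic]
    congr 1
    ext x; simp
  have h2 : (gaussianReal 0 1).real Set.univ ≤ (gaussianReal 0 1).real (Set.Iic 0) +
      (gaussianReal 0 1).real (Set.Ici 0) := by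
    rw [← Set.Iic_union_Ici (a := (0 : ℝ))]
    exact measureReal_union_le _ _
  simp at h2
  linarith

/-- On `[-1, 0)` the standard density is at least `(1/3)(1/2) = 1/6`. This linear gain converts a
deficit in depth into a distance. -/
lemma add_div_six_le_gaussianReal_Ici_neg {s : ℝ} (hs0 : 0 ≤ s) (hs1 : s ≤ 1) :
    1 / 2 + s / 6 ≤ (gaussianReal 0 1).real (Set.Ici (-s)) := by
  have hU : Set.Ici (-s) = Set.Ico (-s) 0 ∪ Set.Ici 0 := by
    rw [Set.Ico_union_Ici_eq_Ici (by linarith)]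
  have hdisj : Disjoint (Set.Ico (-s) 0) (Set.Ici 0) :=
    Set.disjoint_left.2 fun x hx hx' ↦ not_le.2 hx.2 hx'
  rw [hU, measureReal_union hdisj measurableSet_Ici]
  have hpdf : ∀ x ∈ Set.Ico (-s) 0, ENNReal.ofReal (1 / 6) ≤ gaussianPDF 0 1 x := by
    intro x hx
    refine ENNReal.ofReal_le_ofReal ?_
    rw [gaussianPDFReal]
    have hx2 : x ^ 2 ≤ 1 := by nlinarith [hx.1, hx.2]
    have h1 : (1 / 2 : ℝ) ≤ Real.exp (-(x - 0) ^ 2 / (2 * (1 : ℝ≥0))) := by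
      refine le_trans ?_ (Real.add_one_le_exp _)
      simp; linarith
    have h2 : (1 / 3 : ℝ) ≤ (Real.sqrt (2 * Real.pi * (1 : ℝ≥0)))⁻¹ := by
      rw [one_div]
      refine inv_anti₀ (Real.sqrt_pos.2 (by simp; positivity)) ?_
      rw [Real.sqrt_le_left (by norm_num)]
      simp; linarith [Real.pi_lt_d2]
    nlinarith
  have h1 : ENNReal.ofReal (s / 6) ≤ gaussianReal 0 1 (Set.Ico (-s) 0) := by
    rw [gaussianReal_apply _ one_ne_zero]
    calc ENNReal.ofReal (s / 6) = ∫⁻ _x in Set.Ico (-s) 0, ENNReal.ofReal (1 / 6) := by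
          rw [setLIntegral_const, Real.volume_Ico, ← ENNReal.ofReal_mul (by norm_num)]
          congr 1; ring
      _ ≤ _ := setLIntegral_mono' measurableSet_Ico hpdf
  have h2 : s / 6 ≤ (gaussianReal 0 1).real (Set.Ico (-s) 0) := by
    rw [ENNReal.ofReal_le_iff_le_toReal (measure_ne_top _ _)] at h1
    exact h1
  linarith [half_le_gaussianReal_Ici_zero]

variable {d : ℕ}

lemma multivariateGaussian_one_eq_map (μ : EuclideanSpace ℝ (Fin d)) :
    multivariateGaussian μ 1 = (stdGaussian (EuclideanSpace ℝ (Fin d))).map (fun x ↦ μ + x) := by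
  simp [multivariateGaussian]

lemma multivariateGaussian_real_halfspace (μ v : EuclideanSpace ℝ (Fin d)) (hv : ‖v‖ = 1)
    (s : ℝ) : (multivariateGaussian μ 1).real {x | s ≤ inner ℝ v (x - μ)}
      = (gaussianReal 0 1).real (Set.Ici s) := by
  have h1 : (stdGaussian (EuclideanSpace ℝ (Fin d))).map (innerSL ℝ v) = gaussianReal 0 1 := by
    rw [IsGaussian.map_eq_gaussianReal, integral_strongDual_stdGaussian, variance_dual_stdGaussian]
    simp [hv]
  rw [multivariateGaussian_one_eq_map, map_measureReal_apply (by fun_prop)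
    (isClosed_le continuous_const (by fun_prop)).measurableSet, ← h1,
    map_measureReal_apply (by fun_prop) measurableSet_Ici]
  congr 1
  ext x
  simp

end GaussianTail

/-! ### Geometry of deep points. -/

section Depth

variable {ι E : Type*} [Fintype ι] [NormedAddCommGroup E] [InnerProductSpace ℝ E]

/-- A deep point is close to a point around which every larger shift of a half-space is light. -/
lemma norm_sub_le_of_uniformlyDeep {μ η : E} {z : ι → E} {a b s r : ℝ} (hsr : 0 ≤ s + r)
    (hμ : z ∈ uniformlyDeep ι μ (-s) b) (hη : z ∈ uniformlyDeep ι η (-r) a)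
    (hab : Fintype.card ι < a + b) : ‖η - μ‖ ≤ s + r := by
  classical
  by_contra hcon
  push Not at hcon
  have hpos : 0 < ‖η - μ‖ := hsr.trans_lt hcon
  set v : E := ‖η - μ‖⁻¹ • (η - μ) with hv
  have hv1 : ‖v‖ = 1 := by
    rw [hv, norm_smul, norm_inv, norm_norm, inv_mul_cancel₀ hpos.ne']
  have hvd : inner ℝ v (η - μ) = ‖η - μ‖ := by
    rw [hv, real_inner_smul_left, real_inner_self_eq_norm_sq]
    field_simp
  have h1 := hη v hv1
  have h2 := hμ (-v) (by rw [norm_neg, hv1])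
  -- A common point would give `‖η - μ‖ ≤ s + r`, by adding the two inequalities along `v`.
  have hdisj : Disjoint (halfspacePattern (fun i ↦ z i - η) (-r) v)
      (halfspacePattern (fun i ↦ z i - μ) (-s) (-v)) := by
    rw [Finset.disjoint_left]
    intro i hi hi'
    simp only [halfspacePattern, Finset.mem_filter, Finset.mem_univ, true_and,
      inner_neg_left] at hi hi'
    have : inner ℝ v (z i - μ) = inner ℝ v (z i - η) + inner ℝ v (η - μ) := by
      rw [← inner_add_right]; congr 1; abel
    linarith
  have h3 := Finset.card_le_univ (halfspacePattern (fun i ↦ z i - η) (-r) v ∪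
    halfspacePattern (fun i ↦ z i - μ) (-s) (-v))
  rw [Finset.card_union_of_disjoint hdisj] at h3
  have h4 : ((halfspacePattern (fun i ↦ z i - η) (-r) v).card : ℝ) +
    (halfspacePattern (fun i ↦ z i - μ) (-s) (-v)).card ≤ Fintype.card ι := by exact_mod_cast h3
  linarith

lemma uniformlyDeep_of_norm_sub_le {μ η : E} {z : ι → E} {a r : ℝ}
    (hz : z ∈ uniformlyDeep ι μ 0 a) (h : ‖η - μ‖ ≤ r) : z ∈ uniformlyDeep ι η (-r) a := by
  intro v hv
  refine (hz v hv).trans ?_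
  refine Nat.cast_le.2 (Finset.card_le_card fun i hi ↦ ?_)
  simp only [halfspacePattern, Finset.mem_filter, Finset.mem_univ, true_and] at hi ⊢
  have h1 : inner ℝ v (z i - μ) = inner ℝ v (z i - η) + inner ℝ v (η - μ) := by
    rw [← inner_add_right]; congr 1; abel
  have h2 := real_inner_le_norm v (η - μ)
  rw [hv, one_mul] at h2
  linarith

lemma uniformlyDeep_of_eq_off {μ : E} {x z : ι → E} {s a b k : ℝ} (B : Finset ι)
    (hx : x ∈ uniformlyDeep ι μ s a) (hB : ∀ i ∉ B, z i = x i) (hk : (B.card : ℝ) ≤ k)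
    (hb : b + k ≤ a) : z ∈ uniformlyDeep ι μ s b := by
  classical
  intro v hv
  have h1 := hx v hv
  have hsub : halfspacePattern (fun i ↦ x i - μ) s v ⊆
      halfspacePattern (fun i ↦ z i - μ) s v ∪ B := by
    intro i hi
    by_cases h : i ∈ B
    · exact Finset.mem_union_right _ h
    · refine Finset.mem_union_left _ ?_
      simpa [halfspacePattern, hB i h] using hi
  have h2 := (Finset.card_le_card hsub).trans (Finset.card_union_le _ _)
  have h3 : ((halfspacePattern (fun i ↦ x i - μ) s v).card : ℝ) ≤
    (halfspacePattern (fun i ↦ z i - μ) s v).card + B.card := by exact_mod_cast h2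
  linarith

end Depth

/-! ### Threshold weights, Tukey medians and the minimizing threshold. -/

section Threshold

variable {n d : ℕ}

lemma card_subtype_eq_numBelow (lam : Fin n → I) (t : I) :
    Fintype.card {i // lam i ≤ t} = numBelow lam t := by
  rw [numBelow, Fintype.card_subtype]

lemma sum_thresholdWeights_eq (lam : Fin n → I) (t : I) (z : Fin n → EuclideanSpace ℝ (Fin d))
    (η v : EuclideanSpace ℝ (Fin d)) [∀ i, Decidable (0 ≤ inner ℝ v (z i - η))] :
    ∑ i, thresholdWeights lam t i * (if 0 ≤ inner ℝ v (z i - η) then 1 else 0)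
      = (halfspacePattern (fun i : {i // lam i ≤ t} ↦ z i - η) 0 v).card / numBelow lam t := by
  classical
  have h1 : (halfspacePattern (fun i : {i // lam i ≤ t} ↦ z i - η) 0 v).card
      = (Finset.univ.filter fun i ↦ lam i ≤ t ∧ 0 ≤ inner ℝ v (z i - η)).card := by
    rw [← Finset.card_map (Function.Embedding.subtype _)]
    congr 1
    ext i
    simp [halfspacePattern, and_comm]
  rw [h1, Finset.card_eq_sum_ones, Finset.sum_filter, Nat.cast_sum, Finset.sum_div]
  refine Finset.sum_congr rfl fun i _ ↦ ?_
  unfold thresholdWeights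
  by_cases h1 : lam i ≤ t <;> by_cases h2 : 0 ≤ inner ℝ v (z i - η) <;> simp [h1, h2]

lemma div_le_tukeyDepth_iff (hd : 1 ≤ d) (lam : Fin n → I) (t : I) (hN : 0 < numBelow lam t)
    (z : Fin n → EuclideanSpace ℝ (Fin d)) (η : EuclideanSpace ℝ (Fin d)) (a : ℝ) :
    a / numBelow lam t ≤ tukeyDepth (thresholdWeights lam t) z η ↔
      (fun i : {i // lam i ≤ t} ↦ z i) ∈ uniformlyDeep _ η 0 a := by
  have : Nonempty (Fin d) := ⟨⟨0, hd⟩⟩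
  have : Nonempty (Metric.sphere (0 : EuclideanSpace ℝ (Fin d)) 1) :=
    (NormedSpace.sphere_nonempty.2 zero_le_one).to_subtype
  have hN' : (0 : ℝ) < numBelow lam t := by exact_mod_cast hN
  unfold tukeyDepth
  simp only [sum_thresholdWeights_eq]
  rw [le_ciInf_iff ⟨0, by rintro _ ⟨v, rfl⟩; positivity⟩]
  constructor
  · intro h v hv
    have := h ⟨v, by simpa using hv⟩
    rwa [div_le_div_iff_of_pos_right hN'] at this
  · intro h v
    have := h v (by simp)
    rwa [div_le_div_iff_of_pos_right hN']

/-- Weighted Tukey medians exist, because the depth takes finitely many values. -/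
lemma exists_isTukeyMedian (hd : 1 ≤ d) (w : Fin n → ℝ) (z : Fin n → EuclideanSpace ℝ (Fin d)) :
    ∃ η, IsTukeyMedian w z η := by
  classical
  have : Nonempty (Fin d) := ⟨⟨0, hd⟩⟩
  have : Nonempty (Metric.sphere (0 : EuclideanSpace ℝ (Fin d)) 1) :=
    (NormedSpace.sphere_nonempty.2 zero_le_one).to_subtype
  set A : Set ℝ := Set.range fun T : Finset (Fin n) ↦ ∑ i ∈ T, w i with hA
  have hAfin : A.Finite := Set.finite_range _
  have hmem : ∀ η, tukeyDepth w z η ∈ A := by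
    intro η
    have hsub : (Set.range fun v : Metric.sphere (0 : EuclideanSpace ℝ (Fin d)) 1 ↦
        ∑ i, w i * (if 0 ≤ inner ℝ (v : EuclideanSpace ℝ (Fin d)) (z i - η) then 1 else 0))
          ⊆ A := by
      rintro _ ⟨v, rfl⟩
      refine ⟨Finset.univ.filter fun i ↦
        0 ≤ inner ℝ (v : EuclideanSpace ℝ (Fin d)) (z i - η), ?_⟩
      simp [Finset.sum_filter]
    have := (Set.range_nonempty _).csInf_mem (hAfin.subset hsub)
    refine hsub ?_
    convert! this using 1
  have hfin : (Set.range (tukeyDepth w z)).Finite :=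
    hAfin.subset (by rintro _ ⟨η, rfl⟩; exact hmem η)
  obtain ⟨_, ⟨η, rfl⟩, hη⟩ := Set.exists_max_image _ id hfin (Set.range_nonempty _)
  exact ⟨η, fun η' ↦ hη _ ⟨η', rfl⟩⟩

/-- `N` jumps only at values of `lam`, so lowering `s` to the largest such value below it, or to
`0`, keeps `N(s)` and decreases `s²`. A finite set of candidates suffices. -/
lemma exists_le_thresholdObjective (d : ℕ) (lam : Fin n → I) :
    ∃ t : I, ∀ s : I, thresholdObjective d lam t ≤ thresholdObjective d lam s := by
  classical
  set A : Finset I := insert 0 (Finset.univ.image lam) with hA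
  obtain ⟨t, -, ht⟩ := Finset.exists_min_image A (thresholdObjective d lam) ⟨0, by simp [hA]⟩
  refine ⟨t, fun s ↦ ?_⟩
  obtain ⟨u, hu, hmax⟩ := Finset.exists_max_image (A.filter (· ≤ s)) id
    ⟨0, by simp [hA]⟩
  rw [Finset.mem_filter] at hu
  refine (ht u hu.1).trans ?_
  have h1 : numBelow lam u = numBelow lam s := by
    unfold numBelow
    congr 1
    ext i
    simp only [Finset.mem_filter, Finset.mem_univ, true_and]
    exact ⟨fun h ↦ h.trans hu.2, fun h ↦ hmax (lam i) (by simp [hA, h])⟩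
  unfold thresholdObjective
  rw [h1]
  gcongr
  · exact u.2.1
  · exact hu.2

lemma thresholdObjective_eq_ofReal (d : ℕ) (lam : Fin n → I) (t : I) (hN : 0 < numBelow lam t) :
    thresholdObjective d lam t = ENNReal.ofReal ((t : ℝ) ^ 2 + d / numBelow lam t) := by
  rw [thresholdObjective, ENNReal.ofReal_add (by positivity) (by positivity),
    ENNReal.ofReal_div_of_pos (by exact_mod_cast hN), ENNReal.ofReal_natCast,
    ENNReal.ofReal_natCast]

lemma numBelow_pos_of_thresholdObjective_ne_top (hd : 1 ≤ d) (lam : Fin n → I) (t : I)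
    (h : thresholdObjective d lam t ≠ ⊤) : 0 < numBelow lam t := by
  by_contra hcon
  refine h ?_
  have h0 : numBelow lam t = 0 := by omega
  rw [thresholdObjective, h0, Nat.cast_zero, ENNReal.div_zero (by simp; omega), add_top]

lemma effectiveRate_eq_of_forall_le (lam : Fin n → I) (t : I)
    (ht : ∀ s : I, thresholdObjective d lam t ≤ thresholdObjective d lam s) :
    effectiveRate d lam = thresholdObjective d lam t :=
  le_antisymm (iInf_le _ t) (le_iInf ht)

end Threshold

/-! ### Number of corrupted samples below the threshold. -/

section Contamination

variable {n : ℕ} {E : Type*} [MeasurableSpace E]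

open Classical in
lemma pi_bernoulliMeasure_card_ge_le (lam : Fin n → I) (t : I) {e : ℝ} (he : 0 < e) :
    (Measure.pi fun i ↦ bernoulliMeasure true false (lam i))
      {b | e ≤ (Finset.univ.filter fun i : {i // lam i ≤ t} ↦ b i = true).card}
      ≤ ENNReal.ofReal (t * numBelow lam t / e) := by
  set m := Measure.pi fun i ↦ bernoulliMeasure true false (lam i) with hm
  set F : (Fin n → Bool) → ℝ≥0∞ := fun b ↦ ∑ i : {i // lam i ≤ t}, if b i = true then 1 else 0
    with hF
  have hFcard : ∀ b, F b = (Finset.univ.filter fun i : {i // lam i ≤ t} ↦ b i = true).card := by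
    intro b
    simp [hF]
  have hint : ∫⁻ b, F b ∂m ≤ ENNReal.ofReal (t * numBelow lam t) := by
    rw [hF, lintegral_finsetSum _ fun i _ ↦ measurable_of_countable _]
    have h1 : ∀ i : {i // lam i ≤ t}, ∫⁻ b : Fin n → Bool, (if b i = true then 1 else 0) ∂m
        ≤ ENNReal.ofReal t := by
      intro i
      have h2 : (fun b : Fin n → Bool ↦ if b i = true then (1 : ℝ≥0∞) else 0)
          = ((fun b : Fin n → Bool ↦ b i) ⁻¹' {true}).indicator 1 := by
        ext b; simp [Set.indicator]
      rw [h2, lintegral_indicator_one (measurable_pi_apply _ (measurableSet_singleton _)),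
        hm, (measurePreserving_eval _ (i : Fin n)).measure_preimage
          (measurableSet_singleton _).nullMeasurableSet,
        bernoulliMeasure_apply_of_mem_of_notMem _ (by simp) (by simp) (by simp)]
      rw [← ENNReal.ofReal_coe_nnreal]
      exact ENNReal.ofReal_le_ofReal i.2
    refine (Finset.sum_le_sum fun i _ ↦ h1 i).trans ?_
    rw [Finset.sum_const, Finset.card_univ, card_subtype_eq_numBelow, nsmul_eq_mul,
      mul_comm (t : ℝ), ENNReal.ofReal_mul (by positivity), ENNReal.ofReal_natCast]
  have hmark := meas_ge_le_lintegral_div (μ := m) (f := F)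
    (measurable_of_countable F).aemeasurable (ε := ENNReal.ofReal e)
    (by simpa using he) ENNReal.ofReal_ne_top
  rw [ENNReal.ofReal_div_of_pos he]
  refine le_trans (measure_mono ?_) (hmark.trans (ENNReal.div_le_div_right hint _))
  intro b hb
  simp only [Set.mem_ofPred_eq, hFcard] at hb ⊢
  rw [← ENNReal.ofReal_natCast]
  exact ENNReal.ofReal_le_ofReal hb

lemma measurePreserving_restrict_subtype (P : Measure E) [IsProbabilityMeasure P]
    (p : Fin n → Prop) [DecidablePred p] :
    MeasurePreserving (fun (x : Fin n → E) (i : {i // p i}) ↦ x i)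
      (Measure.pi fun _ ↦ P) (Measure.pi fun _ ↦ P) :=
  (measurePreserving_fst (μ := Measure.pi fun _ : {i // p i} ↦ P)
    (ν := Measure.pi fun _ : {i // ¬ p i} ↦ P)).comp
    (measurePreserving_piEquivPiSubtypeProd (fun _ : Fin n ↦ P) p)

end Contamination

/-! ### Upper bound. -/

section UpperBound

variable {n d : ℕ}

/-- The event of the upper bound: around `μ`, half-spaces through `μ` are heavy and half-spaces
at distance `s` are light, among the samples with `lam i ≤ t`. -/
def goodDatasets (lam : Fin n → I) (t : I) (μ : EuclideanSpace ℝ (Fin d)) (s a b : ℝ) :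
    Set (Fin n → EuclideanSpace ℝ (Fin d)) :=
  (fun z (i : {i // lam i ≤ t}) ↦ z i) ⁻¹' (uniformlyDeep _ μ 0 a ∩ uniformlyDeep _ μ (-s) b)

lemma measurableSet_goodDatasets (lam : Fin n → I) (t : I) (μ : EuclideanSpace ℝ (Fin d))
    (s a b : ℝ) : MeasurableSet (goodDatasets lam t μ s a b) :=
  (((isClosed_uniformlyDeep _ _ _).inter (isClosed_uniformlyDeep _ _ _)).preimage
    (by fun_prop)).measurableSet

/-- Three events of probability at most `1/15` are excluded: too few clean points in some half-space
at offset `0`, the same at offset `-s`, and too many flags. They depend only on the clean samples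
and the flags, so the adversary's kernel integrates out. One `e` pays for sampling and one for
corruption. -/
lemma contaminatedLaw_compl_goodDatasets_le (hd : 1 ≤ d) (lam : Fin n → I) (t : I)
    (hN : 0 < numBelow lam t) (μ : EuclideanSpace ℝ (Fin d)) (s : ℝ) {e : ℝ} (he : 0 < e)
    (he1 : 46 * Real.sqrt ((d + 1 : ℕ) * numBelow lam t) / e ≤ 1 / 15)
    (he2 : (t : ℝ) * numBelow lam t / e ≤ 1 / 15)
    (ν : Measure (Fin n → EuclideanSpace ℝ (Fin d)))
    (hν : ν ∈ contaminatedLaws lam (multivariateGaussian μ 1)) :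
    ν (goodDatasets lam t μ s
      (numBelow lam t * (gaussianReal 0 1).real (Set.Ici 0) - 2 * e)
      (numBelow lam t * (gaussianReal 0 1).real (Set.Ici (-s)) - 2 * e))ᶜ ≤ 1 / 5 := by
  classical
  obtain ⟨κ, hκ, rfl⟩ := hν
  have : Nonempty (Fin d) := ⟨⟨0, hd⟩⟩
  have hι : Nonempty {i // lam i ≤ t} := by
    rw [← Fintype.card_pos_iff, card_subtype_eq_numBelow]; exact hN
  set P : Measure (EuclideanSpace ℝ (Fin d)) := multivariateGaussian μ 1 with hP
  set mX := Measure.pi fun _ : Fin n ↦ P with hmX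
  set mB := Measure.pi fun i ↦ bernoulliMeasure true false (lam i) with hmB
  set r : (Fin n → EuclideanSpace ℝ (Fin d)) → ({i // lam i ≤ t} → EuclideanSpace ℝ (Fin d)) :=
    fun z i ↦ z i with hr
  set N : ℝ := (numBelow lam t : ℝ) with hNdef
  have hcardN : (Fintype.card {i // lam i ≤ t} : ℝ) = N := by rw [card_subtype_eq_numBelow]
  set U : ℝ → Set ({i // lam i ≤ t} → EuclideanSpace ℝ (Fin d)) := fun s ↦
    (uniformlyDeep _ μ s (N * (gaussianReal 0 1).real (Set.Ici s) - e))ᶜ with hU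
  have hUm : ∀ s, MeasurableSet (U s) := fun s ↦
    (isClosed_uniformlyDeep _ _ _).measurableSet.compl
  have hUle : ∀ s, mX (r ⁻¹' U s) ≤ ENNReal.ofReal (1 / 15) := by
    intro s
    rw [hmX, (measurePreserving_restrict_subtype P fun i ↦ lam i ≤ t).measure_preimage
      (hUm s).nullMeasurableSet]
    have := measure_compl_uniformlyDeep_le (ι := {i // lam i ≤ t}) P μ s _
      (fun v hv ↦ multivariateGaussian_real_halfspace μ v hv s) he
    rw [hcardN, finrank_euclideanSpace_fin] at this
    exact this.trans (ENNReal.ofReal_le_ofReal he1)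
  set W : Set (Fin n → Bool) :=
    {b | e ≤ (Finset.univ.filter fun i : {i // lam i ≤ t} ↦ b i = true).card} with hW
  have hWle : mB W ≤ ENNReal.ofReal (1 / 15) :=
    (pi_bernoulliMeasure_card_ge_le lam t he).trans (ENNReal.ofReal_le_ofReal he2)
  set bad : Set ((Fin n → EuclideanSpace ℝ (Fin d)) × (Fin n → Bool)) :=
    Prod.fst ⁻¹' (r ⁻¹' U 0 ∪ r ⁻¹' U (-s)) ∪ Prod.snd ⁻¹' W with hbad
  have hrm : Measurable r := by rw [hr]; fun_prop
  have hm1 : MeasurableSet (r ⁻¹' U 0 ∪ r ⁻¹' U (-s)) := (hrm (hUm 0)).union (hrm (hUm (-s)))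
  have hm2 : MeasurableSet W := MeasurableSet.of_discrete
  have hbadm : MeasurableSet bad := (measurable_fst hm1).union (measurable_snd hm2)
  have hZm : Measurable (fun (q : ((Fin n → EuclideanSpace ℝ (Fin d)) × (Fin n → Bool)) ×
      (Fin n → EuclideanSpace ℝ (Fin d))) i ↦ if q.1.2 i = true then q.2 i else q.1.1 i) := by
    refine measurable_pi_lambda _ fun i ↦ Measurable.ite ?_ (by fun_prop) (by fun_prop)
    exact (show Measurable fun q : ((Fin n → EuclideanSpace ℝ (Fin d)) × (Fin n → Bool)) ×
      (Fin n → EuclideanSpace ℝ (Fin d)) ↦ q.1.2 i by fun_prop) (measurableSet_singleton true)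
  rw [Measure.map_apply hZm (measurableSet_goodDatasets ..).compl]
  have hsub : (fun (q : ((Fin n → EuclideanSpace ℝ (Fin d)) × (Fin n → Bool)) ×
      (Fin n → EuclideanSpace ℝ (Fin d))) i ↦ if q.1.2 i = true then q.2 i else q.1.1 i) ⁻¹'
      (goodDatasets lam t μ s (N * (gaussianReal 0 1).real (Set.Ici 0) - 2 * e)
      (N * (gaussianReal 0 1).real (Set.Ici (-s)) - 2 * e))ᶜ ⊆ Prod.fst ⁻¹' bad := by
    rintro ⟨⟨x, b⟩, y⟩ hq
    by_contra hcon
    simp only [hbad, Set.mem_preimage, Set.mem_union, not_or, hU, Set.mem_compl_iff,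
      not_not, hW, Set.mem_ofPred_eq, not_le] at hcon
    obtain ⟨⟨h0, h1⟩, h2⟩ := hcon
    refine hq ?_
    have hoff : ∀ i ∉ Finset.univ.filter fun i : {i // lam i ≤ t} ↦ b i = true,
        r (fun i ↦ if b i = true then y i else x i) i = r x i := by
      intro i hi
      simp only [Finset.mem_filter, Finset.mem_univ, true_and] at hi
      simp [hr, hi]
    exact ⟨uniformlyDeep_of_eq_off _ h0 hoff h2.le (by linarith),
      uniformlyDeep_of_eq_off _ h1 hoff h2.le (by linarith)⟩
  refine (measure_mono hsub).trans ?_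
  rw [← Measure.map_apply measurable_fst hbadm, ← Measure.fst, Measure.fst_compProd]
  refine (measure_union_le _ _).trans ?_
  have e1 : (mX.prod mB) (Prod.fst ⁻¹' (r ⁻¹' U 0 ∪ r ⁻¹' U (-s))) =
      mX (r ⁻¹' U 0 ∪ r ⁻¹' U (-s)) :=
    (measurePreserving_fst (μ := mX) (ν := mB)).measure_preimage hm1.nullMeasurableSet
  have e2 : (mX.prod mB) (Prod.snd ⁻¹' W) = mB W :=
    (measurePreserving_snd (μ := mX) (ν := mB)).measure_preimage hm2.nullMeasurableSet
  rw [e1, e2]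
  calc _ ≤ ENNReal.ofReal (1 / 15) + ENNReal.ofReal (1 / 15) + ENNReal.ofReal (1 / 15) :=
        add_le_add ((measure_union_le _ _).trans (add_le_add (hUle 0) (hUle (-s)))) hWle
    _ = 1 / 5 := by
        rw [← ENNReal.ofReal_add (by norm_num) (by norm_num),
          ← ENNReal.ofReal_add (by norm_num) (by norm_num)]
        rw [show (1 / 15 + 1 / 15 + 1 / 15 : ℝ) = 1 / 5 by norm_num,
          ENNReal.ofReal_div_of_pos (by norm_num)]
        simp

/-- Radii and depths for which every dataset outside an event of probability `1 / 5` is good. -/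
lemma exists_radius_goodDatasets (hd : 1 ≤ d) (lam : Fin n → I) (t : I)
    (hN : 0 < numBelow lam t) (hF : (t : ℝ) ^ 2 + d / numBelow lam t ≤ 1 / 10 ^ 10) :
    ∃ s a b : ℝ, 0 < s ∧ (2 * s) ^ 2 < 10 ^ 10 * ((t : ℝ) ^ 2 + d / numBelow lam t) ∧
      numBelow lam t < a + b ∧ ∀ μ : EuclideanSpace ℝ (Fin d),
        ∀ ν ∈ contaminatedLaws lam (multivariateGaussian μ 1),
          ν (goodDatasets lam t μ s a b)ᶜ ≤ 1 / 5 := by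
  set N : ℝ := (numBelow lam t : ℝ) with hNdef
  have hN0 : 0 < N := by rw [hNdef]; exact_mod_cast hN
  have hd1 : (1 : ℝ) ≤ d := by exact_mod_cast hd
  set g : ℝ := Real.sqrt (d / N) with hg
  have hg0 : 0 < g := Real.sqrt_pos.2 (by positivity)
  have hg2 : g ^ 2 = d / N := Real.sq_sqrt (by positivity)
  have ht0 : 0 ≤ (t : ℝ) := t.2.1
  set ρ : ℝ := t + g with hρ
  have hρ0 : 0 < ρ := by positivity
  have hρ2 : ρ ^ 2 ≤ 2 * ((t : ℝ) ^ 2 + d / N) := by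
    rw [← hg2, hρ]; nlinarith [sq_nonneg ((t : ℝ) - g)]
  -- This is where `f ≤ 10⁻¹⁰` enters: the linear Gaussian gain is only available for `s ≤ 1`.
  have hρ1 : 25000 * ρ ≤ 1 := by
    by_contra hcon
    push Not at hcon
    have : 1 < (25000 * ρ) ^ 2 := by nlinarith
    nlinarith
  -- Large enough for both `1/15` bounds, while `s = 25000 ρ` makes the gain `s N / 6` exceed the
  -- total loss `4 e`.
  set e : ℝ := 1000 * ρ * N with he
  have he0 : 0 < e := by positivity
  refine ⟨25000 * ρ, N * (gaussianReal 0 1).real (Set.Ici 0) - 2 * e,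
    N * (gaussianReal 0 1).real (Set.Ici (-(25000 * ρ))) - 2 * e, by positivity, ?_, ?_, ?_⟩
  · have : 0 < (t : ℝ) ^ 2 + d / N := by positivity
    nlinarith
  · have h1 := half_le_gaussianReal_Ici_zero
    have h2 := add_div_six_le_gaussianReal_Ici_neg (s := 25000 * ρ) (by positivity) hρ1
    have h3 : N * (1 / 2) ≤ N * (gaussianReal 0 1).real (Set.Ici 0) := by gcongr
    have h4 : N * (1 / 2 + 25000 * ρ / 6) ≤
      N * (gaussianReal 0 1).real (Set.Ici (-(25000 * ρ))) := by gcongr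
    have h5 : 0 < ρ * N := by positivity
    rw [he]
    nlinarith
  · intro μ ν hν
    refine contaminatedLaw_compl_goodDatasets_le hd lam t hN μ _ he0 ?_ ?_ ν hν
    · rw [div_le_iff₀ he0]
      -- The constant is `17/12 > √2`, which suffices as `d + 1 ≤ 2 d`; it is tight enough for `46 ·
      -- 17/12 ≤ 1000/15`.
      have h1 : Real.sqrt ((d + 1 : ℕ) * N) ≤ 3 / 2 * (g * N) - g * N / 12 := by
        rw [Real.sqrt_le_left (by nlinarith [mul_pos hg0 hN0])]
        have : (g * N) ^ 2 = d * N := by rw [mul_pow, hg2]; field_simp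
        push_cast
        nlinarith
      have h2 : g * N ≤ ρ * N := by gcongr; linarith
      rw [he]
      nlinarith
    · rw [div_le_iff₀ he0, he]
      have : (t : ℝ) * N ≤ ρ * N := by gcongr; linarith
      nlinarith

lemma enorm_sq_lt_of_norm_le {E : Type*} [NormedAddCommGroup E] {x : E} {r A B : ℝ} (hA : 0 ≤ A)
    (hx : ‖x‖ ≤ r) (hr : r ^ 2 < A * B) :
    ‖x‖ₑ ^ 2 < ENNReal.ofReal A * ENNReal.ofReal B := by
  rw [← ofReal_norm, ← ENNReal.ofReal_pow (norm_nonneg _), ← ENNReal.ofReal_mul hA]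
  have h1 : ‖x‖ ^ 2 ≤ r ^ 2 := pow_le_pow_left₀ (norm_nonneg _) hx 2
  exact (ENNReal.ofReal_lt_ofReal_iff_of_nonneg (by positivity)).2 (h1.trans_lt hr)

/-- An estimator which is accurate on good datasets attains the rate. -/
lemma iSup_contaminatedLaws_le_of_goodDatasets {lam : Fin n → I} {t : I} {s a b : ℝ} {A B : ℝ}
    (hA : 0 ≤ A) (hs : (2 * s) ^ 2 < A * B)
    (hgood : ∀ μ : EuclideanSpace ℝ (Fin d),
      ∀ ν ∈ contaminatedLaws lam (multivariateGaussian μ 1),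
        ν (goodDatasets lam t μ s a b)ᶜ ≤ 1 / 5)
    (M : (Fin n → EuclideanSpace ℝ (Fin d)) → EuclideanSpace ℝ (Fin d))
    (hM : ∀ μ, ∀ z ∈ goodDatasets lam t μ s a b, ‖M z - μ‖ ≤ 2 * s) :
    (⨆ P ∈ idGaussians d, ⨆ ν ∈ contaminatedLaws lam P,
      ν {z | ENNReal.ofReal A * ENNReal.ofReal B ≤ ‖M z - ∫ x, x ∂P‖ₑ ^ 2}) ≤ 1 / 5 := by
  refine iSup₂_le fun P hP ↦ iSup₂_le fun ν hν ↦ ?_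
  obtain ⟨μ, rfl⟩ := hP
  -- Only monotonicity of the outer measure is used, so `M` need not be measurable.
  refine (measure_mono fun z hz hzg ↦ ?_).trans (hgood μ ν hν)
  simp only [integral_id_multivariateGaussian, Set.mem_ofPred_eq] at hz
  exact not_lt.2 hz (enorm_sq_lt_of_norm_le hA (hM μ z hzg) hs)

lemma isTukeyMedian_norm_sub_le (hd : 1 ≤ d) {lam : Fin n → I} {t : I} (hN : 0 < numBelow lam t)
    {s a b : ℝ} (hs : 0 < s) (hab : numBelow lam t < a + b) {μ η : EuclideanSpace ℝ (Fin d)}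
    {z : Fin n → EuclideanSpace ℝ (Fin d)} (hz : z ∈ goodDatasets lam t μ s a b)
    (hη : IsTukeyMedian (thresholdWeights lam t) z η) : ‖η - μ‖ ≤ 2 * s := by
  have h1 := (div_le_tukeyDepth_iff hd lam t hN z μ a).2 hz.1
  have h2 := (div_le_tukeyDepth_iff hd lam t hN z η a).1 (h1.trans (hη μ))
  have h3 := norm_sub_le_of_uniformlyDeep (r := 0) (by linarith) hz.2 (by rwa [neg_zero])
    (by rwa [card_subtype_eq_numBelow])
  linarith

/-- The first point of a dense sequence with large relaxed depth is a measurable estimator. -/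
lemma exists_measurable_estimator (lam : Fin n → I) (t : I) {s a b : ℝ} (hs : 0 < s)
    (hab : numBelow lam t < a + b) :
    ∃ M : (Fin n → EuclideanSpace ℝ (Fin d)) → EuclideanSpace ℝ (Fin d), Measurable M ∧
      ∀ μ, ∀ z ∈ goodDatasets lam t μ s a b, ‖M z - μ‖ ≤ 2 * s := by
  classical
  set q : ℕ → EuclideanSpace ℝ (Fin d) := TopologicalSpace.denseSeq _ with hq
  set r : (Fin n → EuclideanSpace ℝ (Fin d)) → ({i // lam i ≤ t} → EuclideanSpace ℝ (Fin d)) :=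
    fun z i ↦ z i with hr
  set D : ℕ → Set (Fin n → EuclideanSpace ℝ (Fin d)) := fun k ↦
    r ⁻¹' uniformlyDeep _ (q k) (-s) a with hD
  have hDm : ∀ k, MeasurableSet (D k) := fun k ↦
    ((isClosed_uniformlyDeep _ _ _).preimage (by fun_prop)).measurableSet
  -- The second alternative makes the search total: it returns index `0` when no candidate is deep.
  -- On good datasets a candidate within `s` of `μ` is deep, and the relaxed depth costs the second
  -- `s` in `2 * s`.
  have hex : ∀ z, ∃ k, z ∈ D k ∨ ∀ j, z ∉ D j := by
    intro z
    by_cases h : ∃ k, z ∈ D k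
    · exact ⟨_, Or.inl h.choose_spec⟩
    · exact ⟨0, Or.inr (not_exists.1 h)⟩
  have hm : ∀ k, MeasurableSet {z | z ∈ D k ∨ ∀ j, z ∉ D j} := by
    intro k
    have : {z | z ∈ D k ∨ ∀ j, z ∉ D j} = D k ∪ ⋂ j, (D j)ᶜ := by ext; simp
    rw [this]
    exact (hDm k).union (MeasurableSet.iInter fun j ↦ (hDm j).compl)
  refine ⟨fun z ↦ q (Nat.find (hex z)),
    (measurable_from_top (f := q)).comp (measurable_find hex hm), fun μ z hz ↦ ?_⟩
  obtain ⟨k, hk⟩ : ∃ k, ‖q k - μ‖ < s := by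
    obtain ⟨k, hk⟩ := (TopologicalSpace.denseRange_denseSeq
      (EuclideanSpace ℝ (Fin d))).exists_dist_lt μ hs
    exact ⟨k, by rwa [dist_comm, dist_eq_norm] at hk⟩
  have hzk : z ∈ D k := uniformlyDeep_of_norm_sub_le hz.1 hk.le
  have hfind : z ∈ D (Nat.find (hex z)) := by
    rcases Nat.find_spec (hex z) with h | h
    · exact h
    · exact absurd hzk (h k)
  have h3 := norm_sub_le_of_uniformlyDeep (by linarith) hz.2 hfind
    (by rwa [card_subtype_eq_numBelow])
  linarith

end UpperBound

/-! ### Densities of product measures. -/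

section ProductDensity

variable {ι : Type*} [Fintype ι] {X : ι → Type*} [∀ i, MeasurableSpace (X i)]
  (μ : ∀ i, Measure (X i)) [∀ i, IsProbabilityMeasure (μ i)]

lemma lintegral_pi_prod (f : ∀ i, X i → ℝ≥0∞) (hf : ∀ i, Measurable (f i)) :
    ∫⁻ x, ∏ i, f i (x i) ∂Measure.pi μ = ∏ i, ∫⁻ y, f i y ∂μ i := by
  rw [lintegral_prod_eq_prod_lintegral_of_indepFun Finset.univ
    (fun i (x : ∀ i, X i) ↦ f i (x i))
    (iIndepFun_pi fun i ↦ (hf i).aemeasurable) (fun i ↦ (hf i).comp (measurable_pi_apply i))]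
  exact Finset.prod_congr rfl fun i _ ↦
    (measurePreserving_eval μ i).lintegral_comp (hf i)

lemma pi_withDensity (ν : ∀ i, Measure (X i)) [∀ i, IsProbabilityMeasure (ν i)]
    (f : ∀ i, X i → ℝ≥0∞) (hf : ∀ i, Measurable (f i))
    (hν : ∀ i, ν i = (μ i).withDensity (f i)) :
    Measure.pi ν = (Measure.pi μ).withDensity fun x ↦ ∏ i, f i (x i) := by
  refine Measure.pi_eq fun s hs ↦ ?_
  rw [withDensity_apply _ (MeasurableSet.univ_pi hs),
    ← lintegral_indicator (MeasurableSet.univ_pi hs)]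
  have h1 : ∀ x : ∀ i, X i, (Set.univ.pi s).indicator (fun x ↦ ∏ i, f i (x i)) x
      = ∏ i, (s i).indicator (f i) (x i) := by
    intro x
    by_cases hx : x ∈ Set.univ.pi s
    · rw [Set.indicator_of_mem hx]
      exact Finset.prod_congr rfl fun i _ ↦ (Set.indicator_of_mem (hx i trivial) _).symm
    · rw [Set.indicator_of_notMem hx]
      simp only [Set.mem_pi, Set.mem_univ, true_imp_iff, not_forall] at hx
      obtain ⟨i, hi⟩ := hx
      exact (Finset.prod_eq_zero (Finset.mem_univ i) (Set.indicator_of_notMem hi _)).symm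
  simp_rw [h1]
  rw [lintegral_pi_prod μ (fun i ↦ (s i).indicator (f i)) fun i ↦ (hf i).indicator (hs i)]
  refine Finset.prod_congr rfl fun i _ ↦ ?_
  rw [lintegral_indicator (hs i), hν i, withDensity_apply _ (hs i)]

end ProductDensity

/-! ### Le Cam's two-point bound. -/

section Testing

/-- Le Cam's bound: a small second moment of the likelihood ratio makes two laws hard to tell
apart. -/
lemma measure_le_add_of_lintegral_sq_le {X : Type*} [MeasurableSpace X] {ν ν' : Measure X}
    [IsProbabilityMeasure ν] [IsProbabilityMeasure ν'] {g : X → ℝ} (hg : Measurable g)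
    (hg0 : ∀ x, 0 ≤ g x) (hν : ν' = ν.withDensity fun x ↦ ENNReal.ofReal (g x)) {θ : ℝ}
    (hθ : 0 < θ) (hsq : ∫⁻ x, ENNReal.ofReal (g x) ^ 2 ∂ν ≤ ENNReal.ofReal (1 + θ ^ 2))
    {A : Set X} (hA : MeasurableSet A) : ν A ≤ ν' A + ENNReal.ofReal θ := by
  have hG : Measurable fun x ↦ ENNReal.ofReal (g x) := hg.ennreal_ofReal
  set G : X → ℝ≥0∞ := fun x ↦ ENNReal.ofReal (g x) with hGdef
  have hG1 : ∫⁻ x, G x ∂ν = 1 := by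
    rw [← setLIntegral_univ, ← withDensity_apply _ MeasurableSet.univ, ← hν, measure_univ]
  -- A subtraction-free form of `2 θ 1_A (1 - g) ≤ θ² + (1 - g)²`; on `A` it says `(θ - 1 + g)² ≥
  -- 0`. Integrating replaces Cauchy–Schwarz.
  have hpt : ∀ x, A.indicator (fun _ ↦ ENNReal.ofReal (2 * θ)) x + 2 * G x
      ≤ A.indicator (fun x ↦ ENNReal.ofReal (2 * θ) * G x) x +
        (ENNReal.ofReal (θ ^ 2 + 1) + G x ^ 2) := by
    intro x
    have h2 : (2 : ℝ≥0∞) = ENNReal.ofReal 2 := by simp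
    have hx := hg0 x
    by_cases h : x ∈ A
    · rw [Set.indicator_of_mem h, Set.indicator_of_mem h, hGdef, h2]
      simp only
      rw [← ENNReal.ofReal_mul (by positivity), ← ENNReal.ofReal_mul (by positivity),
        ← ENNReal.ofReal_pow hx, ← ENNReal.ofReal_add (by positivity) (by positivity),
        ← ENNReal.ofReal_add (by positivity) (by positivity),
        ← ENNReal.ofReal_add (by positivity) (by positivity)]
      refine ENNReal.ofReal_le_ofReal ?_
      nlinarith [sq_nonneg (θ - 1 + g x)]
    · rw [Set.indicator_of_notMem h, Set.indicator_of_notMem h, hGdef, h2, zero_add, zero_add]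
      simp only
      rw [← ENNReal.ofReal_mul (by positivity), ← ENNReal.ofReal_pow hx,
        ← ENNReal.ofReal_add (by positivity) (by positivity)]
      refine ENNReal.ofReal_le_ofReal ?_
      nlinarith [sq_nonneg (1 - g x), sq_nonneg θ]
  have hint := lintegral_mono (μ := ν) hpt
  rw [lintegral_add_left (measurable_const.indicator hA), lintegral_indicator hA,
    setLIntegral_const, lintegral_const_mul _ hG, hG1,
    lintegral_add_left ((hG.const_mul _).indicator hA), lintegral_indicator hA,
    lintegral_const_mul _ hG, ← withDensity_apply _ hA, ← hν,
    lintegral_add_left measurable_const, lintegral_const, measure_univ, mul_one, mul_one] at hint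
  have hfin : ν A ≠ ⊤ := measure_ne_top _ _
  have hfin' : ν' A ≠ ⊤ := measure_ne_top _ _
  have hint2 := hint.trans (add_le_add_right (add_le_add_right hsq _) _)
  rw [← ENNReal.ofReal_toReal hfin, ← ENNReal.ofReal_toReal hfin',
    show (2 : ℝ≥0∞) = ENNReal.ofReal 2 by simp, ← ENNReal.ofReal_mul (by positivity),
    ← ENNReal.ofReal_mul (by positivity), ← ENNReal.ofReal_add (by positivity) (by positivity),
    ← ENNReal.ofReal_add (by positivity) (by positivity),
    ← ENNReal.ofReal_add (by positivity) (by positivity),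
    ENNReal.ofReal_le_ofReal_iff (by positivity)] at hint2
  rw [← ENNReal.ofReal_toReal hfin, ← ENNReal.ofReal_toReal hfin',
    ← ENNReal.ofReal_add (by positivity) (by positivity)]
  refine ENNReal.ofReal_le_ofReal ?_
  nlinarith

end Testing

/-! ### Gaussian likelihood ratios. -/

section GaussianDensity

lemma gaussianReal_eq_withDensity (m m' : ℝ) :
    gaussianReal m' 1 = (gaussianReal m 1).withDensity fun x ↦
      ENNReal.ofReal (Real.exp ((m' - m) * (x - m) - (m' - m) ^ 2 / 2)) := by
  rw [gaussianReal_of_var_ne_zero _ one_ne_zero, gaussianReal_of_var_ne_zero _ one_ne_zero,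
    ← withDensity_mul _ (measurable_gaussianPDF _ _) (by fun_prop)]
  congr 1
  ext x
  simp only [Pi.mul_apply, gaussianPDF_def]
  rw [← ENNReal.ofReal_mul (gaussianPDFReal_nonneg _ _ _)]
  congr 1
  simp only [gaussianPDFReal]
  rw [mul_assoc _ (Real.exp _) (Real.exp _), ← Real.exp_add]
  congr 2
  simp only [NNReal.coe_one]
  ring

variable {d : ℕ}

lemma multivariateGaussian_one_eq_map_pi (m : EuclideanSpace ℝ (Fin d)) :
    multivariateGaussian m 1 =
      (Measure.pi fun j ↦ gaussianReal (m j) 1).map (WithLp.toLp 2) := by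
  rw [multivariateGaussian_one_eq_map, ← map_pi_eq_stdGaussian,
    Measure.map_map (by fun_prop) (by fun_prop)]
  have h1 : (fun x ↦ m + x) ∘ (WithLp.toLp 2 : (Fin d → ℝ) → EuclideanSpace ℝ (Fin d))
      = WithLp.toLp 2 ∘ fun x j ↦ m j + x j := by
    ext x j; simp
  rw [h1, ← Measure.map_map (by fun_prop) (by fun_prop)]
  congr 1
  have h2 : ∀ j, (gaussianReal 0 1).map (fun x ↦ m j + x) = gaussianReal (m j) 1 := by
    intro j; rw [gaussianReal_map_const_add]; simp
  have h3 := Measure.pi_map_pi (μ := fun _ : Fin d ↦ gaussianReal 0 1)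
    (f := fun j x ↦ m j + x) (hμ := fun j ↦ by rw [h2]; infer_instance)
    (fun j ↦ by fun_prop)
  simp only [h2] at h3
  exact h3

/-- The likelihood ratio of two Gaussians with identity covariance. -/
noncomputable def gaussianRatio (m m' x : EuclideanSpace ℝ (Fin d)) : ℝ :=
  Real.exp (inner ℝ (m' - m) (x - m) - ‖m' - m‖ ^ 2 / 2)

lemma measurable_gaussianRatio (m m' : EuclideanSpace ℝ (Fin d)) :
    Measurable (gaussianRatio m m') := by
  unfold gaussianRatio
  fun_prop

lemma gaussianRatio_toLp (m m' : EuclideanSpace ℝ (Fin d)) (x : Fin d → ℝ) :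
    gaussianRatio m m' (WithLp.toLp 2 x) =
      ∏ j, Real.exp ((m' j - m j) * (x j - m j) - (m' j - m j) ^ 2 / 2) := by
  rw [gaussianRatio, ← Real.exp_sum, EuclideanSpace.real_norm_sq_eq, Finset.sum_sub_distrib,
    Finset.sum_div]
  simp [PiLp.inner_apply, mul_comm]

lemma multivariateGaussian_eq_withDensity (m m' : EuclideanSpace ℝ (Fin d)) :
    multivariateGaussian m' 1 = (multivariateGaussian m 1).withDensity fun x ↦
      ENNReal.ofReal (gaussianRatio m m' x) := by
  have hm := (measurable_gaussianRatio m m').ennreal_ofReal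
  ext s hs
  rw [withDensity_apply _ hs, multivariateGaussian_one_eq_map_pi m,
    setLIntegral_map hs hm (by fun_prop), multivariateGaussian_one_eq_map_pi m',
    Measure.map_apply (by fun_prop) hs,
    pi_withDensity (fun j ↦ gaussianReal (m j) 1) (fun j ↦ gaussianReal (m' j) 1)
      (fun j x ↦ ENNReal.ofReal (Real.exp ((m' j - m j) * (x - m j) - (m' j - m j) ^ 2 / 2)))
      (fun j ↦ by fun_prop) (fun j ↦ gaussianReal_eq_withDensity _ _),
    withDensity_apply _ (hs.preimage (by fun_prop))]
  congr 1
  ext x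
  rw [gaussianRatio_toLp, ENNReal.ofReal_prod_of_nonneg fun j _ ↦ (Real.exp_pos _).le]

/-- The squared ratio is `exp ‖m' - m‖²` times the ratio towards the mean `m + 2 (m' - m)`, which
integrates to `1`. -/
lemma lintegral_gaussianRatio_sq (m m' : EuclideanSpace ℝ (Fin d)) :
    ∫⁻ x, ENNReal.ofReal (gaussianRatio m m' x) ^ 2 ∂(multivariateGaussian m 1)
      = ENNReal.ofReal (Real.exp (‖m' - m‖ ^ 2)) := by
  have h1 : ∀ x, ENNReal.ofReal (gaussianRatio m m' x) ^ 2 =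
      ENNReal.ofReal (Real.exp (‖m' - m‖ ^ 2)) *
        ENNReal.ofReal (gaussianRatio m (m + (2 : ℝ) • (m' - m)) x) := by
    intro x
    unfold gaussianRatio
    rw [← ENNReal.ofReal_pow (Real.exp_pos _).le, ← ENNReal.ofReal_mul (Real.exp_pos _).le,
      ← Real.exp_nat_mul, ← Real.exp_add]
    congr 2
    rw [add_sub_cancel_left, real_inner_smul_left, norm_smul, mul_pow]
    simp
    ring
  simp_rw [h1]
  rw [lintegral_const_mul _ (measurable_gaussianRatio _ _).ennreal_ofReal, ← setLIntegral_univ,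
    ← withDensity_apply _ MeasurableSet.univ, ← multivariateGaussian_eq_withDensity, measure_univ,
    mul_one]

lemma exp_four_mul_sq_le {a : ℝ} (ha : a ^ 2 ≤ 1 / 4) :
    Real.exp (4 * a ^ 2) ≤ 1 + (3 * a) ^ 2 := by
  have h1 := Real.abs_exp_sub_one_sub_id_le (x := 4 * a ^ 2) (by
    rw [abs_of_nonneg (by positivity)]; linarith)
  have h2 := le_of_abs_le h1
  nlinarith [sq_nonneg a]

/-- The integrand is the maximum of the likelihood ratios of `N(a, 1)` and `N(-a, 1)`. Split at `0`:
its integral is `1` plus the difference of the two laws on `[0, ∞)`, at most `3a` by Le Cam's bound.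
-/
lemma lintegral_exp_mul_abs_le {a : ℝ} (ha0 : 0 < a) (ha : a ^ 2 ≤ 1 / 4) :
    ∫⁻ x, ENNReal.ofReal (Real.exp (a * |x| - a ^ 2 / 2)) ∂(gaussianReal 0 1)
      ≤ ENNReal.ofReal (1 + 3 * a) := by
  have hsq : ∫⁻ x, ENNReal.ofReal (Real.exp ((-a - a) * (x - a) - (-a - a) ^ 2 / 2)) ^ 2
      ∂(gaussianReal a 1) ≤ ENNReal.ofReal (1 + (3 * a) ^ 2) := by
    have h1 : ∀ x, ENNReal.ofReal (Real.exp ((-a - a) * (x - a) - (-a - a) ^ 2 / 2)) ^ 2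
        = ENNReal.ofReal (Real.exp (4 * a ^ 2)) *
          ENNReal.ofReal (Real.exp ((-3 * a - a) * (x - a) - (-3 * a - a) ^ 2 / 2)) := by
      intro x
      rw [← ENNReal.ofReal_pow (Real.exp_pos _).le, ← ENNReal.ofReal_mul (Real.exp_pos _).le,
        ← Real.exp_nat_mul, ← Real.exp_add]
      congr 2
      push_cast
      ring
    simp_rw [h1]
    rw [lintegral_const_mul _ (by fun_prop), ← setLIntegral_univ,
      ← withDensity_apply _ MeasurableSet.univ, ← gaussianReal_eq_withDensity, measure_univ,
      mul_one]
    exact ENNReal.ofReal_le_ofReal (exp_four_mul_sq_le ha)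
  have htest := measure_le_add_of_lintegral_sq_le (ν := gaussianReal a 1)
    (ν' := gaussianReal (-a) 1) (by fun_prop) (fun x ↦ (Real.exp_pos _).le)
    (gaussianReal_eq_withDensity a (-a)) (θ := 3 * a) (by positivity) hsq
    (measurableSet_Ici (a := (0 : ℝ)))
  have h1 : ∫⁻ x in Set.Ici 0, ENNReal.ofReal (Real.exp (a * |x| - a ^ 2 / 2)) ∂(gaussianReal 0 1)
      = gaussianReal a 1 (Set.Ici 0) := by
    rw [gaussianReal_eq_withDensity 0 a, withDensity_apply _ measurableSet_Ici]
    refine setLIntegral_congr_fun measurableSet_Ici fun x hx ↦ ?_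
    simp only [abs_of_nonneg (show (0 : ℝ) ≤ x from hx), sub_zero]
  have h2 : ∫⁻ x in (Set.Ici 0)ᶜ, ENNReal.ofReal (Real.exp (a * |x| - a ^ 2 / 2))
      ∂(gaussianReal 0 1) = gaussianReal (-a) 1 (Set.Ici 0)ᶜ := by
    rw [gaussianReal_eq_withDensity 0 (-a), withDensity_apply _ measurableSet_Ici.compl]
    refine setLIntegral_congr_fun measurableSet_Ici.compl fun x hx ↦ ?_
    have hx' : x < 0 := by simpa using hx
    simp only [abs_of_neg hx', sub_zero, neg_sq]
    ring_nf
  rw [← lintegral_add_compl _ (measurableSet_Ici (a := (0 : ℝ))), h1, h2]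
  calc _ ≤ gaussianReal (-a) 1 (Set.Ici 0) + ENNReal.ofReal (3 * a)
        + gaussianReal (-a) 1 (Set.Ici 0)ᶜ := by gcongr
    _ = gaussianReal (-a) 1 (Set.Ici 0) + gaussianReal (-a) 1 (Set.Ici 0)ᶜ
        + ENNReal.ofReal (3 * a) := by ring
    _ = _ := by
        rw [measure_add_measure_compl measurableSet_Ici, measure_univ,
          ENNReal.ofReal_add (by norm_num) (by positivity), ENNReal.ofReal_one]

end GaussianDensity

/-! ### Adversaries with independent outliers. -/

section MixtureLaws

variable {n : ℕ} {E : Type*} [MeasurableSpace E]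

lemma map_ite_bernoulli (P Q : Measure E) [IsProbabilityMeasure P] [IsProbabilityMeasure Q]
    (p : I) :
    ((P.prod (bernoulliMeasure true false p)).prod Q).map
        (fun q : (E × Bool) × E ↦ if q.1.2 = true then q.2 else q.1.1)
      = unitInterval.toNNReal p • Q + unitInterval.toNNReal (unitInterval.symm p) • P := by
  have hf : Measurable (fun q : (E × Bool) × E ↦ if q.1.2 = true then q.2 else q.1.1) := by
    refine Measurable.ite ?_ (by fun_prop) (by fun_prop)
    exact (show Measurable fun q : (E × Bool) × E ↦ q.1.2 by fun_prop)
      (measurableSet_singleton true)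
  rw [bernoulliMeasure_def, Measure.prod_add, Measure.prod_smul_right, Measure.prod_smul_right,
    Measure.prod_dirac, Measure.prod_dirac, Measure.add_prod, Measure.prod_smul_left,
    Measure.prod_smul_left, Measure.map_add _ _ hf, Measure.map_smul, Measure.map_smul]
  have h1 : ∀ b : Bool, ((P.map fun x ↦ (x, b)).prod Q).map
      (fun q : (E × Bool) × E ↦ if q.1.2 = true then q.2 else q.1.1)
      = (P.prod Q).map fun q ↦ if b = true then q.2 else q.1 := by
    intro b
    have : (P.map fun x ↦ (x, b)).prod Q = (P.prod Q).map (Prod.map (fun x ↦ (x, b)) id) := by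
      rw [← Measure.map_prod_map _ _ (by fun_prop) measurable_id, Measure.map_id]
    rw [this, Measure.map_map hf (by fun_prop)]
    rfl
  rw [h1, h1]
  simp only [if_true, Bool.false_eq_true, if_false]
  have e1 := (measurePreserving_snd (μ := P) (ν := Q)).map_eq
  have e2 := (measurePreserving_fst (μ := P) (ν := Q)).map_eq
  rw [show (fun q : E × E ↦ q.2) = Prod.snd from rfl,
    show (fun q : E × E ↦ q.1) = Prod.fst from rfl, e1, e2]

/-- An adversary drawing independent outliers produces independent mixtures. -/
lemma pi_mixture_mem_contaminatedLaws (lam : Fin n → I) (P : Measure E) [IsProbabilityMeasure P]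
    (Q : Fin n → Measure E) [∀ i, IsProbabilityMeasure (Q i)] (L : Fin n → Measure E)
    (hL : ∀ i, unitInterval.toNNReal (lam i) • Q i +
      unitInterval.toNNReal (unitInterval.symm (lam i)) • P = L i) :
    Measure.pi L ∈ contaminatedLaws lam P := by
  refine ⟨Kernel.const _ (Measure.pi Q), inferInstance, ?_⟩
  rw [Measure.compProd_const]
  set B : Fin n → Measure Bool := fun i ↦ bernoulliMeasure true false (lam i) with hB
  have h1 := measurePreserving_arrowProdEquivProdArrow E Bool (Fin n) (fun _ ↦ P) B
  have h2 := measurePreserving_arrowProdEquivProdArrow (E × Bool) E (Fin n)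
    (fun i ↦ P.prod (B i)) Q
  have h3 := (h1.prod (MeasurePreserving.id (Measure.pi Q))).comp h2
  have hf : ∀ i : Fin n, Measurable
      (fun q : (E × Bool) × E ↦ if q.1.2 = true then q.2 else q.1.1) := by
    intro i
    refine Measurable.ite ?_ (by fun_prop) (by fun_prop)
    exact (show Measurable fun q : (E × Bool) × E ↦ q.1.2 by fun_prop)
      (measurableSet_singleton true)
  have hZm : Measurable (fun (q : ((Fin n → E) × (Fin n → Bool)) × (Fin n → E)) i ↦
      if q.1.2 i = true then q.2 i else q.1.1 i) := by
    refine measurable_pi_lambda _ fun i ↦ Measurable.ite ?_ (by fun_prop) (by fun_prop)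
    exact (show Measurable fun q : ((Fin n → E) × (Fin n → Bool)) × (Fin n → E) ↦ q.1.2 i by
      fun_prop) (measurableSet_singleton true)
  have hL' : ∀ i, ((P.prod (B i)).prod (Q i)).map
      (fun q : (E × Bool) × E ↦ if q.1.2 = true then q.2 else q.1.1) = L i := fun i ↦ by
    rw [← hL i, ← map_ite_bernoulli]
  have h4 := Measure.pi_map_pi (μ := fun i ↦ (P.prod (B i)).prod (Q i))
    (f := fun _ (q : (E × Bool) × E) ↦ if q.1.2 = true then q.2 else q.1.1)
    (hμ := fun i ↦ by
      have := Measure.isProbabilityMeasure_map (μ := (P.prod (B i)).prod (Q i))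
        (hf i).aemeasurable
      infer_instance) (fun i ↦ (hf i).aemeasurable)
  simp only [hL'] at h4
  rw [← h4, ← h3.map_eq, Measure.map_map hZm h3.measurable]
  rfl

/-- If `(1 - p) P ≤ Q`, contaminating `P` at level `p` can produce `Q`. -/
lemma exists_mixture_eq (P Q : Measure E) [IsProbabilityMeasure P] [IsProbabilityMeasure Q]
    (p : I) (hp : p ≠ 0) (hle : unitInterval.toNNReal (unitInterval.symm p) • P ≤ Q) :
    ∃ Q' : Measure E, IsProbabilityMeasure Q' ∧
      unitInterval.toNNReal p • Q' + unitInterval.toNNReal (unitInterval.symm p) • P = Q := by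
  set c := unitInterval.toNNReal p with hc
  set c' := unitInterval.toNNReal (unitInterval.symm p) with hc'
  have hsum : c + c' = 1 := unitInterval.toNNReal_add_toNNReal_symm p
  have hc0 : c ≠ 0 := fun h ↦ hp (by
    ext; rw [← unitInterval.coe_toNNReal, ← hc, h]; simp)
  refine ⟨c⁻¹ • (Q - c' • P), ⟨?_⟩, ?_⟩
  · rw [Measure.smul_apply, Measure.sub_apply MeasurableSet.univ hle, Measure.smul_apply,
      measure_univ, measure_univ]
    have h1 : (1 : ℝ≥0∞) - c' • (1 : ℝ≥0∞) = c := by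
      rw [ENNReal.smul_def, smul_eq_mul, mul_one, ← ENNReal.coe_one, ← hsum, ENNReal.coe_add]
      exact ENNReal.add_sub_cancel_right ENNReal.coe_ne_top
    rw [h1, ENNReal.smul_def, smul_eq_mul, ← ENNReal.coe_mul, inv_mul_cancel₀ hc0]
    rfl
  · rw [smul_smul, mul_inv_cancel₀ hc0, one_smul, Measure.sub_add_cancel_of_le hle]

end MixtureLaws

/-! ### A law dominating all vertices of a cube. -/

section Cube

variable {d : ℕ}

/-- The vertices of the cube of side `2 a` spanned by the coordinates in `J`. -/
noncomputable def cubeMean (J : Finset (Fin d)) (a : ℝ) (sgn : Fin d → Bool) :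
    EuclideanSpace ℝ (Fin d) :=
  WithLp.toLp 2 fun j ↦ if j ∈ J then (if sgn j then a else -a) else 0

/-- The upper envelope of the likelihood ratios of the vertices of the cube. -/
noncomputable def cubeEnvelope (J : Finset (Fin d)) (a : ℝ) (x : Fin d → ℝ) : ℝ :=
  ∏ j, if j ∈ J then Real.exp (a * |x j| - a ^ 2 / 2) else 1

lemma measurable_cubeEnvelope (J : Finset (Fin d)) (a : ℝ) : Measurable (cubeEnvelope J a) := by
  unfold cubeEnvelope
  refine Finset.measurable_fun_prod _ fun j _ ↦ ?_
  split_ifs <;> fun_prop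

lemma gaussianRatio_cubeMean_le (J : Finset (Fin d)) {a : ℝ} (ha : 0 ≤ a) (sgn : Fin d → Bool)
    (x : Fin d → ℝ) : gaussianRatio 0 (cubeMean J a sgn) (WithLp.toLp 2 x) ≤ cubeEnvelope J a x := by
  rw [gaussianRatio_toLp, cubeEnvelope]
  refine Finset.prod_le_prod (fun j _ ↦ (Real.exp_pos _).le) fun j _ ↦ ?_
  by_cases hj : j ∈ J
  · simp only [cubeMean, hj, if_true, PiLp.zero_apply, sub_zero]
    refine Real.exp_le_exp.2 ?_
    split_ifs
    · linarith [mul_le_mul_of_nonneg_left (le_abs_self (x j)) ha]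
    · linarith [mul_le_mul_of_nonneg_left (neg_le_abs (x j)) ha, neg_sq a]
  · simp [cubeMean, hj]

lemma lintegral_cubeEnvelope_le (J : Finset (Fin d)) {a : ℝ} (ha0 : 0 < a) (ha : a ^ 2 ≤ 1 / 4) :
    ∫⁻ x, ENNReal.ofReal (cubeEnvelope J a x) ∂(Measure.pi fun _ ↦ gaussianReal 0 1)
      ≤ ENNReal.ofReal (Real.exp (3 * a * J.card)) := by
  have h1 : ∀ x, ENNReal.ofReal (cubeEnvelope J a x) = ∏ j,
      (fun y : ℝ ↦ if j ∈ J then ENNReal.ofReal (Real.exp (a * |y| - a ^ 2 / 2)) else 1) (x j) := by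
    intro x
    rw [cubeEnvelope, ENNReal.ofReal_prod_of_nonneg fun j _ ↦ by split_ifs <;> positivity]
    refine Finset.prod_congr rfl fun j _ ↦ ?_
    by_cases hj : j ∈ J <;> simp [hj]
  simp_rw [h1]
  rw [lintegral_pi_prod (fun _ : Fin d ↦ gaussianReal 0 1)
    (fun j y ↦ if j ∈ J then ENNReal.ofReal (Real.exp (a * |y| - a ^ 2 / 2)) else 1)
    (fun j ↦ by split_ifs <;> fun_prop)]
  calc _ ≤ ∏ j, (if j ∈ J then ENNReal.ofReal (1 + 3 * a) else 1) := by
        refine Finset.prod_le_prod' fun j _ ↦ ?_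
        by_cases hj : j ∈ J
        · simp only [hj, if_true]
          exact lintegral_exp_mul_abs_le ha0 ha
        · simp [hj]
    _ = ENNReal.ofReal ((1 + 3 * a) ^ J.card) := by
        rw [Finset.prod_ite_mem, Finset.univ_inter, Finset.prod_const,
          ENNReal.ofReal_pow (by positivity)]
    _ ≤ _ := by
        refine ENNReal.ofReal_le_ofReal ?_
        rw [mul_comm (3 * a), Real.exp_nat_mul]
        gcongr
        linarith [Real.add_one_le_exp (3 * a)]

/-- A single law dominates all vertices of the cube, up to the contamination level. -/
lemma exists_common_law (J : Finset (Fin d)) {a : ℝ} (ha0 : 0 < a) (ha : a ^ 2 ≤ 1 / 4) :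
    ∃ Q : Measure (EuclideanSpace ℝ (Fin d)), IsProbabilityMeasure Q ∧
      ∀ (sgn : Fin d → Bool) (p : I), 3 * a * J.card ≤ p →
        unitInterval.toNNReal (unitInterval.symm p) •
          multivariateGaussian (cubeMean J a sgn) 1 ≤ Q := by
  set γ : Measure (EuclideanSpace ℝ (Fin d)) := multivariateGaussian 0 1 with hγ
  set h : EuclideanSpace ℝ (Fin d) → ℝ≥0∞ := fun x ↦ ENNReal.ofReal (cubeEnvelope J a x.ofLp)
    with hh
  have hhm : Measurable h := ((measurable_cubeEnvelope J a).comp (by fun_prop)).ennreal_ofReal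
  set D := γ.withDensity h with hD
  set Z : ℝ≥0∞ := D Set.univ with hZ
  have hPD : ∀ sgn, multivariateGaussian (cubeMean J a sgn) 1 ≤ D := by
    intro sgn
    rw [multivariateGaussian_eq_withDensity 0 (cubeMean J a sgn)]
    exact withDensity_mono (ae_of_all _ fun x ↦ ENNReal.ofReal_le_ofReal
      (gaussianRatio_cubeMean_le J ha0.le sgn x.ofLp))
  have hZle : Z ≤ ENNReal.ofReal (Real.exp (3 * a * J.card)) := by
    rw [hZ, hD, withDensity_apply _ MeasurableSet.univ, setLIntegral_univ, hγ,
      multivariateGaussian_one_eq_map_pi, lintegral_map hhm (by fun_prop)]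
    exact lintegral_cubeEnvelope_le J ha0 ha
  have hZ1 : 1 ≤ Z := by
    have := hPD (fun _ ↦ true) Set.univ
    rwa [measure_univ] at this
  have hZ0 : Z ≠ 0 := (zero_lt_one.trans_le hZ1).ne'
  have hZt : Z ≠ ⊤ := (hZle.trans_lt ENNReal.ofReal_lt_top).ne
  refine ⟨Z⁻¹ • D, ⟨by
    rw [Measure.smul_apply, smul_eq_mul, ← hZ, ENNReal.inv_mul_cancel hZ0 hZt]⟩, fun sgn p hp ↦ ?_⟩
  -- `1 - p ≤ exp (-p) ≤ exp (-3 a |J|) ≤ 1 / Z`: contamination `p` pays for the excess mass of the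
  -- envelope.
  have hc : (unitInterval.toNNReal (unitInterval.symm p) : ℝ≥0∞) ≤ Z⁻¹ := by
    refine le_trans ?_ (ENNReal.inv_le_inv.2 hZle)
    rw [← ENNReal.ofReal_inv_of_pos (Real.exp_pos _), ← Real.exp_neg,
      ← ENNReal.ofReal_coe_nnreal]
    refine ENNReal.ofReal_le_ofReal ?_
    rw [unitInterval.coe_toNNReal, unitInterval.coe_symm_eq]
    calc 1 - (p : ℝ) ≤ Real.exp (-p) := by linarith [Real.add_one_le_exp (-(p : ℝ))]
      _ ≤ _ := Real.exp_le_exp.2 (by linarith)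
  refine Measure.le_iff.2 fun s _ ↦ ?_
  rw [Measure.smul_apply, Measure.smul_apply, ENNReal.smul_def, smul_eq_mul, smul_eq_mul]
  exact mul_le_mul' hc (hPD sgn s)

lemma norm_sq_cubeMean_sub_le (J : Finset (Fin d)) (a : ℝ) (sgn : Fin d → Bool) (j : Fin d) :
    ‖cubeMean J a (Function.update sgn j (!sgn j)) - cubeMean J a sgn‖ ^ 2 ≤ 4 * a ^ 2 := by
  rw [EuclideanSpace.real_norm_sq_eq, Finset.sum_eq_single j]
  · simp only [cubeMean, PiLp.sub_apply, Function.update_self]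
    by_cases hj : j ∈ J
    · cases sgn j <;> simp [hj] <;> nlinarith
    · simp [hj]; positivity
  · intro i _ hij
    simp [cubeMean, Function.update_of_ne hij]
  · simp

end Cube

/-! ### Assouad's lemma. -/

section Assouad

variable {d : ℕ} {Ω : Type*} [MeasurableSpace Ω]

/-- Assouad's lemma, in probability. -/
lemma exists_card_ne_ge (ν : (Fin d → Bool) → Measure Ω) [∀ sgn, IsProbabilityMeasure (ν sgn)]
    (J : Finset (Fin d)) (hJ : J.Nonempty)
    (hν : ∀ sgn, ∀ j, ∀ A, MeasurableSet A →
      ν sgn A ≤ ν (Function.update sgn j (!sgn j)) A + ENNReal.ofReal (1 / 10))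
    (D : Fin d → Ω → Bool) (hD : ∀ j, Measurable (D j)) :
    ∃ sgn, 3 / 10 ≤ (ν sgn).real {ω | J.card ≤ 10 * (J.filter fun j ↦ D j ω ≠ sgn j).card} := by
  by_contra hcon
  push Not at hcon
  set K : ℝ := (J.card : ℝ) with hK
  have hK0 : 0 < K := by rw [hK]; exact_mod_cast hJ.card_pos
  set A : (Fin d → Bool) → Fin d → Set Ω := fun sgn j ↦ {ω | D j ω ≠ sgn j} with hA
  have hAm : ∀ sgn j, MeasurableSet (A sgn j) := fun sgn j ↦
    (hD j (measurableSet_singleton (sgn j))).compl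
  -- A decision wrong at a vertex is right at its neighbour, and the two laws differ by at most
  -- `1/10` on any event.
  have hpair : ∀ sgn j, 9 / 10 ≤ (ν sgn).real (A sgn j) +
      (ν (Function.update sgn j (!sgn j))).real (A (Function.update sgn j (!sgn j)) j) := by
    intro sgn j
    have h1 : A (Function.update sgn j (!sgn j)) j = (A sgn j)ᶜ := by
      ext ω
      simp only [hA, Function.update_self, Set.mem_ofPred_eq, Set.mem_compl_iff]
      cases D j ω <;> cases sgn j <;> simp
    rw [h1]
    have h2 := hν sgn j (A sgn j)ᶜ (hAm sgn j).compl
    have h3 : (ν sgn).real (A sgn j)ᶜ ≤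
        (ν (Function.update sgn j (!sgn j))).real (A sgn j)ᶜ + 1 / 10 := by
      have := ENNReal.toReal_mono (by finiteness) h2
      rwa [ENNReal.toReal_add (by finiteness) (by finiteness), ENNReal.toReal_ofReal (by norm_num)]
        at this
    have h4 := probReal_add_probReal_compl (μ := ν sgn) (hAm sgn j)
    linarith
  have hsum : ∀ j, 9 / 20 * 2 ^ d ≤ ∑ sgn, (ν sgn).real (A sgn j) := by
    intro j
    have hinv : Function.Involutive fun sgn : Fin d → Bool ↦ Function.update sgn j (!sgn j) := by
      intro sgn; simp
    have h1 := Equiv.sum_comp hinv.toPerm fun sgn ↦ (ν sgn).real (A sgn j)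
    have h2 : ∑ _sgn : Fin d → Bool, (9 / 10 : ℝ) ≤ ∑ sgn, ((ν sgn).real (A sgn j) +
        (ν (Function.update sgn j (!sgn j))).real (A (Function.update sgn j (!sgn j)) j)) :=
      Finset.sum_le_sum fun sgn _ ↦ hpair sgn j
    rw [Finset.sum_add_distrib] at h2
    simp only [Function.Involutive.coe_toPerm] at h1
    rw [h1] at h2
    simp at h2
    linarith
  -- Under the negated claim the expected number of errors is at most `(3/10) K + K/10`, below the
  -- average `(9/20) K` forced by `hsum`.
  have hup : ∀ sgn, ∑ j ∈ J, (ν sgn).real (A sgn j) ≤ 4 / 10 * K := by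
    intro sgn
    set B : Set Ω := {ω | J.card ≤ 10 * (J.filter fun j ↦ D j ω ≠ sgn j).card} with hB
    have hcount : ∀ ω, ∑ j ∈ J, (A sgn j).indicator (fun _ ↦ (1 : ℝ)) ω
        = (J.filter fun j ↦ D j ω ≠ sgn j).card := by
      intro ω
      rw [Finset.card_filter]
      push_cast
      refine Finset.sum_congr rfl fun j _ ↦ ?_
      simp [hA, Set.indicator]
    have hcm : Measurable fun ω ↦ ∑ j ∈ J, (A sgn j).indicator (fun _ ↦ (1 : ℝ)) ω :=
      Finset.measurable_fun_sum _ fun j _ ↦ measurable_const.indicator (hAm sgn j)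
    have hBm : MeasurableSet B := by
      have : B = {ω | K ≤ 10 * ∑ j ∈ J, (A sgn j).indicator (fun _ ↦ (1 : ℝ)) ω} := by
        ext ω
        simp only [hB, Set.mem_ofPred_eq, hcount, hK]
        norm_cast
      rw [this]
      exact measurableSet_le measurable_const (hcm.const_mul _)
    have hi : ∀ j, Integrable ((A sgn j).indicator fun _ ↦ (1 : ℝ)) (ν sgn) := fun j ↦
      (integrable_const _).indicator (hAm sgn j)
    calc ∑ j ∈ J, (ν sgn).real (A sgn j)
        = ∫ ω, ∑ j ∈ J, (A sgn j).indicator (fun _ ↦ (1 : ℝ)) ω ∂(ν sgn) := by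
          rw [integral_finsetSum _ fun j _ ↦ hi j]
          refine Finset.sum_congr rfl fun j _ ↦ ?_
          rw [integral_indicator_const _ (hAm sgn j)]; simp
      _ ≤ ∫ ω, (B.indicator (fun _ ↦ K) ω + K / 10) ∂(ν sgn) := by
          refine integral_mono (integrable_finsetSum _ fun j _ ↦ hi j)
            (((integrable_const _).indicator hBm).add (integrable_const _)) fun ω ↦ ?_
          simp only [hcount]
          by_cases hω : ω ∈ B
          · rw [Set.indicator_of_mem hω]
            have : ((J.filter fun j ↦ D j ω ≠ sgn j).card : ℝ) ≤ K := by
              rw [hK]; exact_mod_cast Finset.card_filter_le _ _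
            linarith
          · rw [Set.indicator_of_notMem hω, zero_add, hK]
            have h1 : 10 * (J.filter fun j ↦ D j ω ≠ sgn j).card < J.card := not_le.1 hω
            have h2 : (10 : ℝ) * (J.filter fun j ↦ D j ω ≠ sgn j).card < J.card := by
              exact_mod_cast h1
            linarith
      _ = K * (ν sgn).real B + K / 10 := by
          rw [integral_add ((integrable_const _).indicator hBm) (integrable_const _),
            integral_indicator_const _ hBm]
          simp [mul_comm]
      _ ≤ _ := by
          have := (hcon sgn).le
          nlinarith
  have h1 : ∑ j ∈ J, ∑ sgn, (ν sgn).real (A sgn j) ≤ ∑ _sgn : Fin d → Bool, 4 / 10 * K := by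
    rw [Finset.sum_comm]
    exact Finset.sum_le_sum fun sgn _ ↦ hup sgn
  have h2 : ∑ _j ∈ J, (9 / 20 * 2 ^ d : ℝ) ≤ ∑ j ∈ J, ∑ sgn, (ν sgn).real (A sgn j) :=
    Finset.sum_le_sum fun j _ ↦ hsum j
  have h3 := h2.trans h1
  simp only [Finset.sum_const, nsmul_eq_mul, Finset.card_univ, Fintype.card_pi, Fintype.card_bool,
    Finset.prod_const, Fintype.card_fin, Nat.cast_pow, Nat.cast_ofNat, ← hK] at h3
  have : (0 : ℝ) < 2 ^ d * K := by positivity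
  linarith

end Assouad

/-! ### Lower bound. -/

section LowerBound

variable {n d : ℕ}

/-- The law of a sample in the lower bound: clean if the contamination level is at most `t`, and
uninformative otherwise. -/
noncomputable def sampleLaw (lam : Fin n → I) (t : I)
    (P Q : Measure (EuclideanSpace ℝ (Fin d))) (i : Fin n) : Measure (EuclideanSpace ℝ (Fin d)) :=
  if lam i ≤ t then P else Q

instance (lam : Fin n → I) (t : I) (P Q : Measure (EuclideanSpace ℝ (Fin d)))
    [IsProbabilityMeasure P] [IsProbabilityMeasure Q] (i : Fin n) :
    IsProbabilityMeasure (sampleLaw lam t P Q i) := by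
  unfold sampleLaw
  split_ifs <;> infer_instance

lemma pi_sampleLaw_mem_contaminatedLaws (lam : Fin n → I) (t : I)
    (P Q : Measure (EuclideanSpace ℝ (Fin d))) [IsProbabilityMeasure P] [IsProbabilityMeasure Q]
    (hQ : ∀ p : I, t ≤ p → unitInterval.toNNReal (unitInterval.symm p) • P ≤ Q) :
    Measure.pi (sampleLaw lam t P Q) ∈ contaminatedLaws lam P := by
  have hex : ∀ i, ∃ Q' : Measure (EuclideanSpace ℝ (Fin d)), IsProbabilityMeasure Q' ∧
      unitInterval.toNNReal (lam i) • Q' +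
        unitInterval.toNNReal (unitInterval.symm (lam i)) • P = sampleLaw lam t P Q i := by
    intro i
    unfold sampleLaw
    split_ifs with h
    -- At a level below the threshold the adversary draws its outliers from `P` itself, so the
    -- sample stays clean.
    · refine ⟨P, inferInstance, ?_⟩
      rw [← add_smul, unitInterval.toNNReal_add_toNNReal_symm, one_smul]
    · rw [not_le] at h
      exact exists_mixture_eq P Q (lam i) (ne_of_gt (lt_of_le_of_lt t.2.1 h)) (hQ _ h.le)
  choose Q' hQ' hmix using hex
  exact pi_mixture_mem_contaminatedLaws lam P Q' _ hmix

lemma pi_sampleLaw_le_add (lam : Fin n → I) (t : I) (Q : Measure (EuclideanSpace ℝ (Fin d)))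
    [IsProbabilityMeasure Q] (m m' : EuclideanSpace ℝ (Fin d))
    (hm : numBelow lam t * ‖m' - m‖ ^ 2 ≤ 1 / 125)
    (A : Set (Fin n → EuclideanSpace ℝ (Fin d))) (hA : MeasurableSet A) :
    Measure.pi (sampleLaw lam t (multivariateGaussian m 1) Q) A ≤
      Measure.pi (sampleLaw lam t (multivariateGaussian m' 1) Q) A + ENNReal.ofReal (1 / 10) := by
  set g : Fin n → EuclideanSpace ℝ (Fin d) → ℝ := fun i x ↦
    if lam i ≤ t then gaussianRatio m m' x else 1 with hg
  have hgm : ∀ i, Measurable (g i) := by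
    intro i
    simp only [hg]
    split_ifs
    · exact measurable_gaussianRatio m m'
    · fun_prop
  have hg0 : ∀ i x, 0 ≤ g i x := by
    intro i x
    simp only [hg, gaussianRatio]
    split_ifs <;> positivity
  have hdens := pi_withDensity (sampleLaw lam t (multivariateGaussian m 1) Q)
    (sampleLaw lam t (multivariateGaussian m' 1) Q) (fun i x ↦ ENNReal.ofReal (g i x))
    (fun i ↦ (hgm i).ennreal_ofReal) (fun i ↦ by
      by_cases h : lam i ≤ t
      · simp only [sampleLaw, hg, h, if_true]
        exact multivariateGaussian_eq_withDensity m m'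
      · simp [sampleLaw, hg, h])
  have hprod : ∀ z : Fin n → EuclideanSpace ℝ (Fin d),
      ∏ i, ENNReal.ofReal (g i (z i)) = ENNReal.ofReal (∏ i, g i (z i)) := fun z ↦
    (ENNReal.ofReal_prod_of_nonneg fun i _ ↦ hg0 i _).symm
  simp only [hprod] at hdens
  have h2 : ∀ i, ∫⁻ x, ENNReal.ofReal (g i x) ^ 2
      ∂(sampleLaw lam t (multivariateGaussian m 1) Q i)
      = if lam i ≤ t then ENNReal.ofReal (Real.exp (‖m' - m‖ ^ 2)) else 1 := by
    intro i
    by_cases h : lam i ≤ t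
    · simp only [sampleLaw, hg, h, if_true]
      exact lintegral_gaussianRatio_sq m m'
    · simp [sampleLaw, hg, h]
  have hGm : Measurable fun z : Fin n → EuclideanSpace ℝ (Fin d) ↦ ∏ i, g i (z i) :=
    Finset.measurable_fun_prod _ fun i _ ↦ (hgm i).comp (measurable_pi_apply i)
  have hG0 : ∀ z : Fin n → EuclideanSpace ℝ (Fin d), 0 ≤ ∏ i, g i (z i) :=
    fun z ↦ Finset.prod_nonneg fun i _ ↦ hg0 i _
  clear_value g
  refine measure_le_add_of_lintegral_sq_le hGm hG0 hdens (θ := 1 / 10) (by norm_num) ?_ hA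
  have h1 : ∀ z : Fin n → EuclideanSpace ℝ (Fin d), ENNReal.ofReal (∏ i, g i (z i)) ^ 2
      = ∏ i, (fun x ↦ ENNReal.ofReal (g i x) ^ 2) (z i) := by
    intro z
    rw [← hprod, Finset.prod_pow]
  simp_rw [h1]
  rw [lintegral_pi_prod _ (fun i x ↦ ENNReal.ofReal (g i x) ^ 2)
    fun i ↦ (hgm i).ennreal_ofReal.pow_const 2]
  rw [Finset.prod_congr rfl fun i _ ↦ h2 i, Finset.prod_ite, Finset.prod_const_one, mul_one,
    Finset.prod_const, ← numBelow, ← ENNReal.ofReal_pow (Real.exp_pos _).le, ← Real.exp_nat_mul]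
  refine ENNReal.ofReal_le_ofReal ?_
  refine (Real.exp_le_exp.2 hm).trans ?_
  -- `exp (1/125) ≤ 1 + 1/125 + 1/125² ≤ 1 + (1/10)²`, the second moment required for `θ = 1/10`.
  have h3 := Real.abs_exp_sub_one_sub_id_le (x := 1 / 125) (by rw [abs_of_pos] <;> norm_num)
  have h4 := le_of_abs_le h3
  linarith

lemma mul_card_le_norm_sq_sub_cubeMean (J : Finset (Fin d)) {a : ℝ} (ha : 0 ≤ a)
    (sgn : Fin d → Bool) (y : EuclideanSpace ℝ (Fin d)) :
    a ^ 2 * (J.filter fun j ↦ decide (0 ≤ y j) ≠ sgn j).card ≤ ‖y - cubeMean J a sgn‖ ^ 2 := by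
  rw [EuclideanSpace.real_norm_sq_eq, mul_comm, ← nsmul_eq_mul, ← Finset.sum_const]
  refine (Finset.sum_le_sum fun j hj ↦ ?_).trans (Finset.sum_le_sum_of_subset_of_nonneg
    (Finset.subset_univ _) fun j _ _ ↦ sq_nonneg _)
  rw [Finset.mem_filter] at hj
  simp only [cubeMean, PiLp.sub_apply, hj.1, if_true]
  have hne := hj.2
  cases hsgn : sgn j
  · rw [hsgn] at hne
    have hy : 0 ≤ y j := by simpa using hne
    simp
    nlinarith
  · rw [hsgn] at hne
    have hy : y j < 0 := by simpa using hne
    simp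
    nlinarith

lemma exists_contaminatedLaw_error_ge (lam : Fin n → I) (t : I) (J : Finset (Fin d))
    (hJ : J.Nonempty) {a : ℝ} (ha0 : 0 < a) (ha : a ^ 2 ≤ 1 / 4) (ht : 3 * a * J.card ≤ t)
    (hN : numBelow lam t * (4 * a ^ 2) ≤ 1 / 125)
    (M : (Fin n → EuclideanSpace ℝ (Fin d)) → EuclideanSpace ℝ (Fin d)) (hM : Measurable M) :
    ∃ P ∈ idGaussians d, ∃ ν ∈ contaminatedLaws lam P,
      ENNReal.ofReal (3 / 10) ≤
        ν {z | ENNReal.ofReal (a ^ 2 * J.card / 10) ≤ ‖M z - ∫ x, x ∂P‖ₑ ^ 2} := by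
  obtain ⟨Q, hQ, hdom⟩ := exists_common_law J ha0 ha
  obtain ⟨sgn, hsgn⟩ := exists_card_ne_ge
    (fun sgn ↦ Measure.pi (sampleLaw lam t (multivariateGaussian (cubeMean J a sgn) 1) Q)) J hJ
    (fun sgn j A hA ↦ pi_sampleLaw_le_add lam t Q _ _
      ((mul_le_mul_of_nonneg_left (norm_sq_cubeMean_sub_le J a sgn j) (by positivity)).trans hN) A hA)
    (fun j z ↦ decide (0 ≤ M z j))
    (fun j ↦ by
      have : Measurable fun z ↦ M z j := by fun_prop
      exact measurable_to_bool (by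
        have h1 : (fun z ↦ decide (0 ≤ M z j)) ⁻¹' {true} = {z | 0 ≤ M z j} := by ext; simp
        rw [h1]
        exact measurableSet_le measurable_const this))
  refine ⟨_, ⟨cubeMean J a sgn, rfl⟩, _, pi_sampleLaw_mem_contaminatedLaws lam t _ Q
    (fun p hp ↦ hdom sgn p (ht.trans hp)), ?_⟩
  refine ((ENNReal.ofReal_le_iff_le_toReal (measure_ne_top _ _)).2 hsgn).trans (measure_mono ?_)
  intro z hz
  simp only [Set.mem_ofPred_eq, integral_id_multivariateGaussian] at hz ⊢
  rw [← ofReal_norm, ← ENNReal.ofReal_pow (norm_nonneg _)]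
  refine ENNReal.ofReal_le_ofReal
    (le_trans ?_ (mul_card_le_norm_sq_sub_cubeMean J ha0.le sgn (M z)))
  have hz' : (J.card : ℝ) ≤ 10 * (J.filter fun j ↦ decide (0 ≤ M z j) ≠ sgn j).card := by
    exact_mod_cast hz
  have := mul_le_mul_of_nonneg_left hz' (sq_nonneg a)
  linarith

lemma ofReal_le_minimaxPAC (lam : Fin n → I) (t : I) (J : Finset (Fin d))
    (hJ : J.Nonempty) {a : ℝ} (ha0 : 0 < a) (ha : a ^ 2 ≤ 1 / 4) (ht : 3 * a * J.card ≤ t)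
    (hN : numBelow lam t * (4 * a ^ 2) ≤ 1 / 125) :
    ENNReal.ofReal (a ^ 2 * J.card / 10) ≤ minimaxPAC lam (idGaussians d) (1 / 5) := by
  refine le_sInf fun r hr ↦ ?_
  by_contra hcon
  push Not at hcon
  have h1 : ENNReal.ofReal (3 / 10) ≤ ⨅ (M : (Fin n → EuclideanSpace ℝ (Fin d)) →
      EuclideanSpace ℝ (Fin d)) (_ : Measurable M), ⨆ P ∈ idGaussians d,
        ⨆ ν ∈ contaminatedLaws lam P, ν {z | r ≤ ‖M z - ∫ x, x ∂P‖ₑ ^ 2} := by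
    refine le_iInf₂ fun M hM ↦ ?_
    obtain ⟨P, hP, ν, hν, hle⟩ := exists_contaminatedLaw_error_ge lam t J hJ ha0 ha ht hN M hM
    refine (hle.trans (measure_mono fun z hz ↦ hcon.le.trans hz)).trans ?_
    exact (le_iSup₂ (f := fun ν (_ : ν ∈ contaminatedLaws lam P) ↦
      ν {z | r ≤ ‖M z - ∫ x, x ∂P‖ₑ ^ 2}) ν hν).trans
      (le_iSup₂ (f := fun P (_ : P ∈ idGaussians d) ↦ ⨆ ν ∈ contaminatedLaws lam P,
        ν {z | r ≤ ‖M z - ∫ x, x ∂P‖ₑ ^ 2}) P hP)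
  have h2 := h1.trans hr
  have h3 : (1 / 5 : ℝ≥0∞) = ENNReal.ofReal (1 / 5) := by
    rw [ENNReal.ofReal_div_of_pos (by norm_num)]; simp
  rw [h3, ENNReal.ofReal_le_ofReal_iff (by norm_num)] at h2
  norm_num at h2

/-- The lower bound on the minimax rate. -/
lemma div_sqrt_le_minimaxPAC (hd : 1 ≤ d) (lam : Fin n → I) {F : ℝ} (hF0 : 0 < F) (hF1 : F ≤ 1)
    (hF : effectiveRate d lam = ENNReal.ofReal F) :
    ENNReal.ofReal (F / Real.sqrt d / 20000) ≤ minimaxPAC lam (idGaussians d) (1 / 5) := by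
  -- The largest dimension, up to constants, for which `(3 a k)² ≤ F / 2` with `a²` of order `F /
  -- d`.
  set k := Nat.sqrt d with hk
  have hk1 : 1 ≤ k := Nat.le_sqrt'.2 (by simpa using hd)
  have hkd : k ^ 2 ≤ d := Nat.sqrt_le' d
  have hkd' : d < (k + 1) ^ 2 := Nat.lt_succ_sqrt' d
  have hd1 : (1 : ℝ) ≤ d := by exact_mod_cast hd
  have hkR1 : (1 : ℝ) ≤ k := by exact_mod_cast hk1
  have hkR : (k : ℝ) ^ 2 ≤ d := by exact_mod_cast hkd
  have hkR' : (d : ℝ) < (k + 1) ^ 2 := by exact_mod_cast hkd'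
  obtain ⟨J, -, hJ⟩ := Finset.exists_subset_card_eq (s := (Finset.univ : Finset (Fin d))) (n := k)
    (by rw [Finset.card_univ, Fintype.card_fin]; exact Nat.sqrt_le_self d)
  have hJn : J.Nonempty := Finset.card_pos.1 (by omega)
  set a : ℝ := Real.sqrt (F / (1000 * d)) with ha
  have ha0 : 0 < a := Real.sqrt_pos.2 (by positivity)
  have ha2 : a ^ 2 = F / (1000 * d) := Real.sq_sqrt (by positivity)
  have had : a ^ 2 * d = F / 1000 := by rw [ha2]; field_simp
  have ha4 : a ^ 2 ≤ 1 / 4 := by nlinarith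
  have hτ2 : (3 * a * k) ^ 2 ≤ F / 2 := by
    have : a ^ 2 * (k : ℝ) ^ 2 ≤ a ^ 2 * d := by gcongr
    nlinarith
  have hτ1 : 3 * a * k ≤ 1 := by
    by_contra hcon
    push Not at hcon
    nlinarith
  set t : I := ⟨3 * a * k, by positivity, hτ1⟩ with ht
  -- The objective at `t` is at least `F` and `t² ≤ F / 2`, so `N(t) ≤ 2 d / F`; with `a² = F /
  -- (1000 d)` this gives exactly `8 / 1000`.
  have hN : numBelow lam t * (4 * a ^ 2) ≤ 1 / 125 := by
    rcases Nat.eq_zero_or_pos (numBelow lam t) with h0 | hpos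
    · rw [h0]; norm_num
    have h1 : effectiveRate d lam ≤ thresholdObjective d lam t := iInf_le _ t
    have hNpos : (0 : ℝ) < numBelow lam t := by exact_mod_cast hpos
    rw [hF, thresholdObjective_eq_ofReal d lam t hpos,
      ENNReal.ofReal_le_ofReal_iff (by positivity)] at h1
    have h2 : F / 2 ≤ d / numBelow lam t := by
      have : (t : ℝ) ^ 2 ≤ F / 2 := hτ2
      linarith
    rw [le_div_iff₀ hNpos] at h2
    rw [ha2, mul_div_assoc', mul_div_assoc', div_le_iff₀ (by positivity)]
    linarith
  refine le_trans (ENNReal.ofReal_le_ofReal ?_)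
    (ofReal_le_minimaxPAC lam t J hJn ha0 ha4 (by rw [hJ]) hN)
  have hs0 : 0 < Real.sqrt d := Real.sqrt_pos.2 (by positivity)
  have hs2 : Real.sqrt d ^ 2 = d := Real.sq_sqrt (by positivity)
  have hsk : Real.sqrt d ≤ 2 * k := by
    rw [Real.sqrt_le_left (by positivity)]
    nlinarith
  rw [hJ, ha2, div_div, div_mul_eq_mul_div, div_div, div_le_div_iff₀ (by positivity)
    (by positivity)]
  have h1 : (d : ℝ) ≤ 2 * k * Real.sqrt d := by nlinarith
  have h2 := mul_le_mul_of_nonneg_left h1 hF0.le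
  nlinarith

end LowerBound

/-! ### The theorem. -/

theorem theorem2 :
    ∃ c c₁ C : ℝ≥0, 0 < c ∧ 0 < c₁ ∧ 0 < C ∧
      ∀ (d n : ℕ) (_ : 1 ≤ d) (lam : Fin n → I), effectiveRate d lam ≤ (c : ℝ≥0∞) →
        (c₁ : ℝ≥0∞) * (effectiveRate d lam / ENNReal.ofReal (Real.sqrt d))
            ≤ minimaxPAC lam (idGaussians d) (1 / 5) ∧
        minimaxPAC lam (idGaussians d) (1 / 5) ≤ (C : ℝ≥0∞) * effectiveRate d lam ∧
        -- the threshold estimator is well defined: the minimum over `t` and the maximal depth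
        -- are attained
        (∃ t : I, ∀ s : I, thresholdObjective d lam t ≤ thresholdObjective d lam s) ∧
        (∀ (t : I) (z : Fin n → EuclideanSpace ℝ (Fin d)),
          ∃ η, IsTukeyMedian (thresholdWeights lam t) z η) ∧
        -- and, for every minimizer `t` and every choice of the Tukey medians, it attains the
        -- upper bound
        ∀ t : I, (∀ s : I, thresholdObjective d lam t ≤ thresholdObjective d lam s) →
          ∀ M : (Fin n → EuclideanSpace ℝ (Fin d)) → EuclideanSpace ℝ (Fin d),
            (∀ z, IsTukeyMedian (thresholdWeights lam t) z (M z)) →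
            (⨆ P ∈ idGaussians d, ⨆ ν ∈ contaminatedLaws lam P,
              ν {z | (C : ℝ≥0∞) * effectiveRate d lam ≤ ‖M z - ∫ x, x ∂P‖ₑ ^ 2}) ≤ 1 / 5 := by
  refine ⟨1 / 10 ^ 10, 1 / 20000, 10 ^ 10, by positivity, by positivity, by positivity,
    fun d n hd lam hf ↦ ?_⟩
  have hrate : ∀ t : I, (∀ s : I, thresholdObjective d lam t ≤ thresholdObjective d lam s) →
      0 < numBelow lam t ∧ 0 < (t : ℝ) ^ 2 + d / numBelow lam t ∧
      (t : ℝ) ^ 2 + d / numBelow lam t ≤ 1 / 10 ^ 10 ∧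
      effectiveRate d lam = ENNReal.ofReal ((t : ℝ) ^ 2 + d / numBelow lam t) := by
    intro t ht
    have heq := effectiveRate_eq_of_forall_le lam t ht
    -- Finiteness of `f` excludes an empty sample, because `d / 0 = ∞` for `d ≥ 1`.
    have hN : 0 < numBelow lam t := by
      refine numBelow_pos_of_thresholdObjective_ne_top hd lam t ?_
      rw [← heq]
      exact (hf.trans_lt ENNReal.coe_lt_top).ne
    have hNR : (0 : ℝ) < numBelow lam t := by exact_mod_cast hN
    have hdR : (0 : ℝ) < d := by exact_mod_cast hd
    rw [thresholdObjective_eq_ofReal d lam t hN] at heq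
    refine ⟨hN, by positivity, ?_, heq⟩
    rw [heq, ← ENNReal.ofReal_coe_nnreal, ENNReal.ofReal_le_ofReal_iff (by positivity)] at hf
    simpa using hf
  have hC : (((10 ^ 10 : ℝ≥0)) : ℝ≥0∞) = ENNReal.ofReal (10 ^ 10) := by
    rw [← ENNReal.ofReal_coe_nnreal]; simp
  obtain ⟨t₀, ht₀⟩ := exists_le_thresholdObjective d lam
  obtain ⟨hN₀, hF0, hF1, hF⟩ := hrate t₀ ht₀
  refine ⟨?_, ?_, ⟨t₀, ht₀⟩, fun t z ↦ exists_isTukeyMedian hd _ z, fun t ht M hM ↦ ?_⟩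
  · refine le_trans (le_of_eq ?_)
      (div_sqrt_le_minimaxPAC hd lam hF0 (hF1.trans (by norm_num)) hF)
    have hsd : 0 < Real.sqrt d := Real.sqrt_pos.2 (by exact_mod_cast hd)
    rw [hF, ← ENNReal.ofReal_div_of_pos hsd, ← ENNReal.ofReal_coe_nnreal,
      ← ENNReal.ofReal_mul (by positivity)]
    congr 1
    push_cast
    ring
  · obtain ⟨s, a, b, hs, hs2, hab, hgood⟩ := exists_radius_goodDatasets hd lam t₀ hN₀ hF1
    obtain ⟨M, hMm, hM⟩ := exists_measurable_estimator (d := d) lam t₀ hs hab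
    rw [hC, hF]
    refine sInf_le ?_
    rw [Set.mem_ofPred_eq]
    exact (iInf₂_le M hMm).trans
      (iSup_contaminatedLaws_le_of_goodDatasets (by positivity) hs2 hgood M hM)
  · obtain ⟨hN, -, hF1', hF'⟩ := hrate t ht
    obtain ⟨s, a, b, hs, hs2, hab, hgood⟩ := exists_radius_goodDatasets hd lam t hN hF1'
    rw [hC, hF']
    exact iSup_contaminatedLaws_le_of_goodDatasets (by positivity) hs2 hgood M
      fun μ z hz ↦ isTukeyMedian_norm_sub_le hd hN hs hab hz (hM z)
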